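/- Let $p\ge 1$, $n_1,\dots,n_p\in\mathbb{N}$ and $V=\mathbb{C}^{n_1}\otimes\cdots\otimes\mathbb{C}^{n_p}$. Fix inner products $\langle\cdot,\cdot\rangle_i$ on $\mathbb{R}^{n_i}$, extended to complex bilinear forms on $\mathbb{C}^{n_i}$, and equip $V$ with the Bombieri–Weyl bilinear form determined by $\langle u_1\otimes\cdots\otimes u_p,\;v_1\otimes\cdots\otimes v_p\rangle=\prod_{i=1}^p\langle u_i,v_i\rangle_i$. Bars denote Zariski closure. For an irreducible affine variety $Y\subseteq V$ and a regular point $y\in Y_{reg}$, let $N_yY$ be the orthogonal complement of the tangent space $T_yY$ with respect to this form, and put $$\operatorname{Con}(Y)=\overline{\{(y,z)\in V\times V\mid y\in Y_{reg},\ z\in N_yY\}},\qquad Y^*=\overline{\{z\mid (y,z)\in \operatorname{Con}(Y)\text{ for some }y\}}.$$ Let $X\subseteq V$ be the variety of tensors of rank at most one (the cone over the variety of rank-one tensors), and $X^*$ its dual variety. Let $$\mathcal{E}_{X^*,X}=\overline{\{(y,x,T)\in V^3\mid (y,x)\in\operatorname{Con}(X^*),\ T=x+y\}},$$ and for $A\subseteq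 X^*$ define the data locus $\operatorname{DL}_A=\overline{\{T\mid (y,x,T)\in\mathcal{E}_{X^*,X}\text{ for some }y\in A,\ x\in V\}}$. Set $\operatorname{DL}_1=X$ and $\operatorname{DL}_r=\operatorname{DL}_{X^*\cap\operatorname{DL}_{r-1}}$ for $r\ge2$. Proposition (Structure of $\operatorname{DL}_r$). For every $r\ge 2$, $$\operatorname{DL}_r=\overline{\{x+y\mid x\in X_{reg},\ y\in N_xX\cap\operatorname{DL}_{r-1}\}}.$$ -/

import Mathlib

open scoped TensorProduct

noncomputable section

namespace TensorDataLocus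

section AffineVarieties

variable {V : Type*} [AddCommGroup V] [Module ℂ V]

/-- The algebra of polynomial functions on a complex vector space `V`: the `ℂ`-algebra of functions
`V → ℂ` generated by the linear forms. -/
def polyFun (V : Type*) [AddCommGroup V] [Module ℂ V] : Subalgebra ℂ (V → ℂ) :=
  Algebra.adjoin ℂ (Set.range fun φ : Module.Dual ℂ V => (fun v => φ v : V → ℂ))

/-- Zariski closure: the common zeros of all polynomial functions vanishing on `S`. -/
def zariskiClosure (S : Set V) : Set V :=
  {v | ∀ f ∈ polyFun V, (∀ s ∈ S, f s = 0) → f v = 0}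

/-- The coordinate ring of `X ⊆ V`: restrictions to `X` of polynomial functions on `V`
(equivalently, polynomial functions modulo those vanishing on `X`). -/
def coordRing (X : Set V) : Subalgebra ℂ (X → ℂ) :=
  Algebra.adjoin ℂ (Set.range fun φ : Module.Dual ℂ V => (fun x => φ x : X → ℂ))

/-- Every polynomial function has a differential at every point. -/
theorem exists_differential {f : V → ℂ} (hf : f ∈ polyFun V) (x : V) :
    ∃ L : V →ₗ[ℂ] ℂ, ∀ v, HasDerivAt (fun t : ℂ => f (x + t • v)) (L v) 0 := by
  induction hf using Algebra.adjoin_induction with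
  | mem f hf =>
    obtain ⟨φ, rfl⟩ := hf
    refine ⟨φ, fun v => ?_⟩
    have h := ((hasDerivAt_id (0 : ℂ)).mul_const (φ v)).const_add (φ x)
    simpa using h
  | algebraMap r => exact ⟨0, fun v => by simpa using hasDerivAt_const (0 : ℂ) r⟩
  | add f g _ _ hf hg =>
    obtain ⟨L, hL⟩ := hf
    obtain ⟨M, hM⟩ := hg
    exact ⟨L + M, fun v => (hL v).add (hM v)⟩
  | mul f g _ _ hf hg =>
    obtain ⟨L, hL⟩ := hf
    obtain ⟨M, hM⟩ := hg
    refine ⟨g x • L + f x • M, fun v => ?_⟩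
    have h := (hL v).mul (hM v)
    simp only [zero_smul, add_zero] at h
    refine h.congr_deriv ?_
    simp only [LinearMap.add_apply, LinearMap.smul_apply, smul_eq_mul]
    ring

/-- The (Zariski) tangent space `T_x X`: the vectors `v` killed by the differential at `x` of every
polynomial function vanishing on `X`. -/
def tangentSpace (X : Set V) (x : V) : Submodule ℂ V where
  carrier := {v | ∀ f ∈ polyFun V, (∀ z ∈ X, f z = 0) → deriv (fun t : ℂ => f (x + t • v)) 0 = 0}
  add_mem' := by
    intro v w hv hw f hf hX
    obtain ⟨L, hL⟩ := exists_differential hf x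
    have h1 := hv f hf hX
    have h2 := hw f hf hX
    rw [(hL _).deriv] at h1 h2 ⊢
    rw [map_add, h1, h2, add_zero]
  zero_mem' := by
    intro f hf hX
    simp
  smul_mem' := by
    intro c v hv f hf hX
    obtain ⟨L, hL⟩ := exists_differential hf x
    have h1 := hv f hf hX
    rw [(hL _).deriv] at h1 ⊢
    rw [map_smul, h1, smul_zero]

/-- The regular points of an irreducible affine variety `X` (Jacobian criterion): the points at
which the tangent space has dimension `dim X`. The dimension of `X` is the transcendence degree of
its coordinate ring over `ℂ`. -/
def regularPoints (X : Set V) : Set V :=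
  {x | x ∈ X ∧ (Module.finrank ℂ (tangentSpace X x) : Cardinal) = Algebra.trdeg ℂ (coordRing X)}

variable (B : LinearMap.BilinForm ℂ V)

/-- The normal space `N_x X`: the orthogonal complement of `T_x X` for the bilinear form `B`. -/
def normalSpace (X : Set V) (x : V) : Submodule ℂ V :=
  B.orthogonal (tangentSpace X x)

/-- The conormal variety `Con(X)`. -/
def conormal (X : Set V) : Set (V × V) :=
  zariskiClosure {q | q.1 ∈ regularPoints X ∧ q.2 ∈ normalSpace B X q.1}

/-- The dual variety `X^*`, realised in the same ambient space by means of `B`. -/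
def dualVariety (X : Set V) : Set V :=
  zariskiClosure (Prod.snd '' conormal B X)

/-- The joint ED correspondence of a variety `Y` and its dual: the closure of the set of triples
`(a, b, T)` with `(a, b) ∈ Con(Y)` and `T = a + b`. -/
def jointED (Y : Set V) : Set (V × V × V) :=
  zariskiClosure {q | (q.1, q.2.1) ∈ conormal B Y ∧ q.2.2 = q.1 + q.2.1}

/-- The data locus `DL_A` of a subvariety `A` of the dual variety `X^*`: the closure of the
projection to the last factor of `E_{X^*,X} ∩ (A × V × V)`. -/
def dataLocus (X A : Set V) : Set V :=
  zariskiClosure ((fun q : V × V × V => q.2.2) '' (jointED B (dualVariety B X) ∩ {q | q.1 ∈ A}))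

/-- The sequence of special data loci `DL_1 = X` and `DL_r = DL_{X^* ∩ DL_{r-1}}` for `r ≥ 2`.
(The value at `0` is a placeholder.) -/
def DL (X : Set V) : ℕ → Set V
  | 0 => {0}
  | 1 => X
  | r + 2 => dataLocus B X (dualVariety B X ∩ DL X (r + 1))

end AffineVarieties

section Tensors

variable {p : ℕ} {n : Fin p → ℕ}

/-- The tensor space `ℂ^{n_1} ⊗ ⋯ ⊗ ℂ^{n_p}`. -/
abbrev TensorSpace (n : Fin p → ℕ) : Type :=
  ⨂[ℂ] i : Fin p, (Fin (n i) → ℂ)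

/-- The cone of tensors of rank at most one. -/
def rankOne (n : Fin p → ℕ) : Set (TensorSpace n) :=
  Set.range fun x : (i : Fin p) → Fin (n i) → ℂ => PiTensorProduct.tprod ℂ x

/-- The Bombieri-Weyl bilinear form on `ℂ^{n_1} ⊗ ⋯ ⊗ ℂ^{n_p}` induced by the inner products
`⟨u, v⟩_i = uᵀ G_i v` on `ℝ^{n_i}`, each extended to a complex bilinear form on `ℂ^{n_i}`. -/
def bwForm (G : ∀ i, Matrix (Fin (n i)) (Fin (n i)) ℝ) : LinearMap.BilinForm ℂ (TensorSpace n) :=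
  PiTensorProduct.dualDistrib ∘ₗ
    PiTensorProduct.map fun i => Matrix.toBilin' ((G i).map ((↑) : ℝ → ℂ))

/-- The defining property of the Bombieri-Weyl form. -/
theorem bwForm_tprod (G : ∀ i, Matrix (Fin (n i)) (Fin (n i)) ℝ)
    (x y : ∀ i, Fin (n i) → ℂ) :
    bwForm G (PiTensorProduct.tprod ℂ x) (PiTensorProduct.tprod ℂ y) =
      ∏ i, ∑ j, ∑ k, x i j * (G i j k : ℂ) * y i k := by
  simp only [bwForm, LinearMap.comp_apply, PiTensorProduct.map_tprod,
    PiTensorProduct.dualDistrib_apply, Matrix.toBilin'_apply, Matrix.map_apply]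

end Tensors

end TensorDataLocus

end

noncomputable section

namespace TensorDataLocus

open Module

/-! ### Polynomial maps, Zariski closed sets and differentials -/

section Polynomials

variable {V W : Type*} [AddCommGroup V] [Module ℂ V] [AddCommGroup W] [Module ℂ W]

/-! The statement is a form of biduality: up to pairs with `x = 0`, the points `(y, x)` of Con(X*)
are those with `x` of rank one and `y` normal to `X` at `x`, so the correspondence consists of
triples `(y, x, x + y)`. This is proved with an arbitrary set `D` in place of DL_{r-1}
(`IsProductForm.dataLocus_inter_eq`), so no induction on `r` is needed.

Tuples of endomorphisms of the factors act on `V`, and the invertible ones are transitive on nonzero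
rank-one tensors. The tangent space of `X` at such an `x` is its infinitesimal orbit
(`regular_range`), so normality of `y` is the bilinear condition `Moment`. The dual variety is
exactly the set of `y` satisfying it for some nonzero `x` of rank at most one (`dualVariety_range`),
because that set is already closed by projective elimination (`isZariskiClosed_elimination`).

Two inclusions replace the general biduality theorem. Let `L` be the normal space of `X` at the base
point `e`.

First, normal pairs lie in Con(X*) (`mem_conormal_dualCone`). The dual cone is swept out by the
translates of `L`. By generic smoothness (`exists_generic_tangentSpace`, `exists_generic_orbit`), a
general `l` in `L` is a regular point whose tangent space is contained in `L` plus the infinitesimal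
orbit of `l`. Both are orthogonal to `e`, and taking closures and translates gives all pairs.

Second, every pair of Con(X*) is of this kind (`of_mem_conormal_dualCone`). A normal vector `x` of
the dual cone at `l` in `L` is orthogonal to `L`, hence tangent to `X` at `e`, say `x = A e`.
Differentiating an equation of the dual cone along the lines `l + t v` in `L` shows that `A (A e)`
is orthogonal to `L` (`apply_der_der_eq_zero`). Its mixed coordinates are the products of components
of `A e` in two different factors; since they vanish, only one factor can move off `e`, and `x` has
rank at most one.

Pairs with `x = 0` give nothing new: if `y` is normal at `x' ≠ 0`, then `y` is the limit of `t x' +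
y` as `t` tends to 0. -/

theorem dual_mem_polyFun (φ : Dual ℂ V) : (fun v => φ v) ∈ polyFun V :=
  Algebra.subset_adjoin ⟨φ, rfl⟩

theorem const_mem_polyFun (c : ℂ) : (fun _ : V => c) ∈ polyFun V :=
  (polyFun V).algebraMap_mem c

/-- A polynomial map between complex vector spaces. -/
def IsPolyMap (φ : V → W) : Prop := ∀ ψ : Dual ℂ W, (fun v => ψ (φ v)) ∈ polyFun V

theorem isPolyMap_linearMap (φ : V →ₗ[ℂ] W) : IsPolyMap (fun v => φ v) :=
  fun ψ => dual_mem_polyFun (ψ ∘ₗ φ)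

theorem isPolyMap_const (w : W) : IsPolyMap (fun _ : V => w) :=
  fun ψ => const_mem_polyFun (ψ w)

theorem IsPolyMap.add {φ ψ : V → W} (hφ : IsPolyMap φ) (hψ : IsPolyMap ψ) :
    IsPolyMap (fun v => φ v + ψ v) := fun χ => by
  simp only [map_add]
  exact (polyFun V).add_mem (hφ χ) (hψ χ)

theorem IsPolyMap.prodMk {U : Type*} [AddCommGroup U] [Module ℂ U] {φ : U → V} {ψ : U → W}
    (hφ : IsPolyMap φ) (hψ : IsPolyMap ψ) : IsPolyMap (fun u => (φ u, ψ u)) := fun χ => by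
  have h : (fun u => χ (φ u, ψ u)) =
      (fun u => (χ ∘ₗ LinearMap.inl ℂ V W) (φ u)) + fun u => (χ ∘ₗ LinearMap.inr ℂ V W) (ψ u) := by
    ext u
    simp [← map_add]
  rw [h]
  exact (polyFun U).add_mem (hφ _) (hψ _)

theorem IsPolyMap.comp_mem {φ : V → W} (hφ : IsPolyMap φ) {f : W → ℂ} (hf : f ∈ polyFun W) :
    (fun v => f (φ v)) ∈ polyFun V := by
  induction hf using Algebra.adjoin_induction with
  | mem f hf =>
    obtain ⟨ψ, rfl⟩ := hf
    exact hφ ψ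
  | algebraMap r => exact const_mem_polyFun r
  | add f g _ _ hf hg => exact (polyFun V).add_mem hf hg
  | mul f g _ _ hf hg => exact (polyFun V).mul_mem hf hg

theorem bilin_mem_polyFun [FiniteDimensional ℂ V] (b : LinearMap.BilinForm ℂ V)
    {φ ψ : W → V} (hφ : IsPolyMap φ) (hψ : IsPolyMap ψ) :
    (fun w => b (φ w) (ψ w)) ∈ polyFun W := by
  let e := finBasis ℂ V
  have h : (fun w => b (φ w) (ψ w)) =
      ∑ i, (fun w => e.coord i (φ w)) * fun w => b (e i) (ψ w) := by
    ext w
    conv_lhs => rw [← e.sum_repr (φ w), map_sum]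
    simp only [map_smul, LinearMap.sum_apply, LinearMap.smul_apply, Finset.sum_apply, Pi.mul_apply,
      smul_eq_mul, Basis.coord_apply]
  rw [h]
  exact Subalgebra.sum_mem _ fun i _ => (polyFun W).mul_mem (hφ _) (hψ _)

/-! ### Zariski closure -/

theorem subset_zariskiClosure (S : Set V) : S ⊆ zariskiClosure S := fun _ hv _ _ h => h _ hv

/-- Zariski closed sets. -/
def IsZariskiClosed (S : Set V) : Prop := zariskiClosure S ⊆ S

theorem isZariskiClosed_zariskiClosure (S : Set V) : IsZariskiClosed (zariskiClosure S) :=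
  fun _ hv f hf h => hv f hf fun _ hs => hs f hf h

theorem zariskiClosure_minimal {S C : Set V} (h : S ⊆ C) (hC : IsZariskiClosed C) :
    zariskiClosure S ⊆ C := fun _ hv => hC fun f hf hz => hv f hf fun s hs => hz s (h hs)

theorem zariskiClosure_mono {S T : Set V} (h : S ⊆ T) : zariskiClosure S ⊆ zariskiClosure T :=
  zariskiClosure_minimal (h.trans (subset_zariskiClosure T)) (isZariskiClosed_zariskiClosure T)

theorem IsZariskiClosed.preimage {C : Set W} (hC : IsZariskiClosed C) {φ : V → W}
    (hφ : IsPolyMap φ) : IsZariskiClosed (φ ⁻¹' C) :=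
  fun _ hv => hC fun _ hf h => hv _ (hφ.comp_mem hf) fun _ hs => h _ hs

theorem isZariskiClosed_of_eqs {J : Type*} {f g : J → V → ℂ} (hf : ∀ j, f j ∈ polyFun V)
    (hg : ∀ j, g j ∈ polyFun V) : IsZariskiClosed {v | ∀ j, f j v = g j v} := fun _ hv j =>
  sub_eq_zero.1 (hv _ ((polyFun V).sub_mem (hf j) (hg j)) fun _ hs => sub_eq_zero.2 (hs j))

theorem isZariskiClosed_zeros {J : Type*} {f : J → V → ℂ} (hf : ∀ j, f j ∈ polyFun V) :
    IsZariskiClosed {v | ∀ j, f j v = 0} :=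
  isZariskiClosed_of_eqs hf fun _ => const_mem_polyFun 0

/-- To show that a polynomial map sends the closure of `S` into a closed set, it suffices to check
the points of `S`. -/
theorem mem_of_mem_zariskiClosure {S : Set V} {C : Set W} (hC : IsZariskiClosed C) {φ : V → W}
    (hφ : IsPolyMap φ) (h : ∀ s ∈ S, φ s ∈ C) {v : V} (hv : v ∈ zariskiClosure S) : φ v ∈ C :=
  zariskiClosure_minimal (C := φ ⁻¹' C) h (hC.preimage hφ) hv

/-! ### Differentials -/

/-- The differential of a polynomial function. -/
def differential {f : V → ℂ} (hf : f ∈ polyFun V) (x : V) : V →ₗ[ℂ] ℂ :=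
  (exists_differential hf x).choose

theorem hasDerivAt_differential {f : V → ℂ} (hf : f ∈ polyFun V) (x v : V) :
    HasDerivAt (fun t : ℂ => f (x + t • v)) (differential hf x v) 0 :=
  (exists_differential hf x).choose_spec v

theorem deriv_eq_differential {f : V → ℂ} (hf : f ∈ polyFun V) (x v : V) :
    deriv (fun t : ℂ => f (x + t • v)) 0 = differential hf x v :=
  (hasDerivAt_differential hf x v).deriv

theorem mem_tangentSpace {X : Set V} {x v : V} :
    v ∈ tangentSpace X x ↔ ∀ f, ∀ hf : f ∈ polyFun V, (∀ z ∈ X, f z = 0) →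
      differential hf x v = 0 :=
  forall₂_congr fun f hf => by rw [deriv_eq_differential hf]

theorem differential_dual (φ : Dual ℂ V) (x v : V) :
    differential (dual_mem_polyFun φ) x v = φ v := by
  refine (hasDerivAt_differential (dual_mem_polyFun φ) x v).unique ?_
  have h := ((hasDerivAt_id (0 : ℂ)).mul_const (φ v)).const_add (φ x)
  simpa using h

theorem differential_const (c : ℂ) (x v : V) : differential (const_mem_polyFun c) x v = 0 :=
  (hasDerivAt_differential _ x v).unique (hasDerivAt_const _ _)

theorem differential_add {f g : V → ℂ} (hf : f ∈ polyFun V) (hg : g ∈ polyFun V) (x v : V) :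
    differential ((polyFun V).add_mem hf hg) x v = differential hf x v + differential hg x v :=
  (hasDerivAt_differential _ x v).unique
    ((hasDerivAt_differential hf x v).add (hasDerivAt_differential hg x v))

theorem differential_smul (c : ℂ) {f : V → ℂ} (hf : f ∈ polyFun V) (x v : V) :
    differential ((polyFun V).smul_mem hf c) x v = c * differential hf x v :=
  (hasDerivAt_differential _ x v).unique ((hasDerivAt_differential hf x v).const_mul c)

theorem differential_mul {f g : V → ℂ} (hf : f ∈ polyFun V) (hg : g ∈ polyFun V) (x v : V) :
    differential ((polyFun V).mul_mem hf hg) x v =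
      differential hf x v * g x + f x * differential hg x v := by
  refine (hasDerivAt_differential _ x v).unique ?_
  have h := (hasDerivAt_differential hf x v).mul (hasDerivAt_differential hg x v)
  simp only [zero_smul, add_zero] at h
  exact h

/-- The chain rule. -/
theorem differential_comp {φ : V → W} (hφ : IsPolyMap φ) {f : W → ℂ} (hf : f ∈ polyFun W)
    {x v : V} {w : W} (hw : ∀ ψ : Dual ℂ W, differential (hφ ψ) x v = ψ w) :
    differential (hφ.comp_mem hf) x v = differential hf (φ x) w := by
  induction hf using Algebra.adjoin_induction with
  | mem f hf =>
    obtain ⟨ψ, rfl⟩ := hf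
    exact (hw ψ).trans (differential_dual ψ _ _).symm
  | algebraMap r => exact (differential_const r x v).trans (differential_const r _ w).symm
  | add f g hf hg ihf ihg =>
    exact (differential_add (hφ.comp_mem hf) (hφ.comp_mem hg) x v).trans
      ((congrArg₂ (· + ·) ihf ihg).trans (differential_add hf hg _ w).symm)
  | mul f g hf hg ihf ihg =>
    refine (differential_mul (hφ.comp_mem hf) (hφ.comp_mem hg) x v).trans
      (Eq.trans ?_ (differential_mul hf hg _ w).symm)
    rw [ihf, ihg]

theorem differential_mem_polyFun {f : V → ℂ} (hf : f ∈ polyFun V) (v : V) :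
    (fun x => differential hf x v) ∈ polyFun V := by
  induction hf using Algebra.adjoin_induction with
  | mem f hf =>
    obtain ⟨ψ, rfl⟩ := hf
    simpa only [differential_dual] using const_mem_polyFun (V := V) (ψ v)
  | algebraMap r =>
    exact (funext fun x => differential_const r x v : _ = fun _ => (0 : ℂ)) ▸ const_mem_polyFun 0
  | add f g hf hg ihf ihg =>
    exact (funext fun x => differential_add hf hg x v) ▸ (polyFun V).add_mem ihf ihg
  | mul f g hf hg ihf ihg =>
    exact (funext fun x => differential_mul hf hg x v) ▸
      (polyFun V).add_mem ((polyFun V).mul_mem ihf hg) ((polyFun V).mul_mem hf ihg)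

theorem continuousAt_line {f : V → ℂ} (hf : f ∈ polyFun V) (x v : V) :
    ContinuousAt (fun t : ℂ => f (x + t • v)) 0 :=
  (hasDerivAt_differential hf x v).continuousAt

/-- A direction in which `X` contains a germ of a line is tangent to `X`. -/
theorem mem_tangentSpace_of_eventually {X : Set V} {x v : V}
    (h : ∀ᶠ t : ℂ in nhds 0, x + t • v ∈ X) : v ∈ tangentSpace X x := fun f _ hX => by
  have h1 : (fun t : ℂ => f (x + t • v)) =ᶠ[nhds 0] fun _ => 0 :=
    h.mono fun t ht => hX _ ht
  rw [h1.deriv_eq, deriv_const]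

theorem mem_tangentSpace_of_line {X : Set V} {x v : V} (h : ∀ t : ℂ, x + t • v ∈ X) :
    v ∈ tangentSpace X x :=
  mem_tangentSpace_of_eventually (Filter.Eventually.of_forall h)

theorem map_mem_tangentSpace (e : V →ₗ[ℂ] W) {X : Set V} {Y : Set W} (h : ∀ x ∈ X, e x ∈ Y)
    {x v : V} (hv : v ∈ tangentSpace X x) : e v ∈ tangentSpace Y (e x) := fun f hf hY => by
  have := hv (fun z => f (e z)) ((isPolyMap_linearMap e).comp_mem hf) fun z hz => hY _ (h z hz)
  simpa only [map_add, map_smul] using this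

/-- A Zariski closed set containing a punctured germ of a line through `x` contains `x`. -/
theorem mem_of_frequently_line {C : Set V} (hC : IsZariskiClosed C) {x v : V}
    (h : ∃ᶠ t : ℂ in nhdsWithin 0 {0}ᶜ, x + t • v ∈ C) : x ∈ C := hC fun f hf hz => by
  by_contra hx
  have h1 : ∀ᶠ t : ℂ in nhds 0, f (x + t • v) ≠ 0 :=
    (continuousAt_line hf x v).eventually_ne (by simpa using hx)
  exact h ((h1.filter_mono nhdsWithin_le_nhds).mono fun t ht hC => ht (hz _ hC))

end Polynomials

/-! ### Polynomial functions as a polynomial ring -/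

section CoordinateRings

variable {V W : Type*} [AddCommGroup V] [Module ℂ V] [AddCommGroup W] [Module ℂ W]

theorem polyFun_eq_adjoin_coord {ι : Type*} [Finite ι] (b : Basis ι ℂ V) :
    polyFun V = Algebra.adjoin ℂ (Set.range fun i => (fun v => b.coord i v : V → ℂ)) := by
  have := Fintype.ofFinite ι
  refine le_antisymm (Algebra.adjoin_le ?_) (Algebra.adjoin_mono ?_)
  · rintro _ ⟨φ, rfl⟩
    have h : (fun v => φ v : V → ℂ) = ∑ i, φ (b i) • (fun v => b.coord i v : V → ℂ) := by
      ext v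
      conv_lhs => rw [← b.sum_repr v, map_sum]
      simp only [map_smul, Finset.sum_apply, Pi.smul_apply, smul_eq_mul, mul_comm,
        Basis.coord_apply]
    show (fun v => φ v : V → ℂ) ∈ _
    rw [h]
    exact Subalgebra.sum_mem _ fun i _ =>
      Subalgebra.smul_mem _ (Algebra.subset_adjoin (Set.mem_range_self i)) _
  · rintro _ ⟨i, rfl⟩
    exact Set.mem_range_self (b.coord i)

theorem aeval_coord_apply {ι : Type*} (b : Basis ι ℂ V) (p : MvPolynomial ι ℂ) (v : V) :
    MvPolynomial.aeval (fun i => (fun v => b.coord i v : V → ℂ)) p v =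
      MvPolynomial.eval (fun i => b.coord i v) p := by
  induction p using MvPolynomial.induction_on with
  | C a => simp
  | add p q hp hq => rw [map_add, map_add, Pi.add_apply, hp, hq]
  | mul_X p i hp =>
    rw [map_mul, map_mul, Pi.mul_apply, hp, MvPolynomial.aeval_X, MvPolynomial.eval_X]

/-- Polynomial functions in coordinates. -/
def polyFunEquiv {ι : Type*} [Finite ι] (b : Basis ι ℂ V) : MvPolynomial ι ℂ ≃ₐ[ℂ] polyFun V :=
  (AlgEquiv.ofInjective (MvPolynomial.aeval fun i => (fun v => b.coord i v : V → ℂ)) (by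
    have := Fintype.ofFinite ι
    intro p q h
    refine MvPolynomial.funext fun x => ?_
    have h1 := congrFun h (∑ i, x i • b i)
    have h2 : (fun i => b.coord i (∑ i, x i • b i)) = x := b.repr_sum_self x
    rwa [aeval_coord_apply, aeval_coord_apply, h2] at h1)).trans
    (Subalgebra.equivOfEq _ _
      ((Algebra.adjoin_range_eq_range_aeval ℂ _).symm.trans (polyFun_eq_adjoin_coord b).symm))

theorem polyFunEquiv_apply {ι : Type*} [Finite ι] (b : Basis ι ℂ V) (p : MvPolynomial ι ℂ)
    (v : V) : (polyFunEquiv b p : V → ℂ) v = MvPolynomial.eval (fun i => b.coord i v) p :=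
  aeval_coord_apply b p v

variable [FiniteDimensional ℂ V]

instance : IsDomain (polyFun V) := (polyFunEquiv (finBasis ℂ V)).symm.toMulEquiv.isDomain _

instance : Algebra.FiniteType ℂ (polyFun V) :=
  Algebra.FiniteType.equiv inferInstance (polyFunEquiv (finBasis ℂ V))

theorem trdeg_polyFun : Algebra.trdeg ℂ (polyFun V) = finrank ℂ V := by
  have h := (polyFunEquiv (finBasis ℂ V)).lift_trdeg_eq
  rw [MvPolynomial.trdeg_of_isDomain] at h
  simpa using h.symm

theorem polyFun_mul_ne_zero {f g : V → ℂ} (hf : f ∈ polyFun V) (hg : g ∈ polyFun V) (hf0 : f ≠ 0)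
    (hg0 : g ≠ 0) : f * g ≠ 0 := by
  have h : (⟨f, hf⟩ * ⟨g, hg⟩ : polyFun V) ≠ 0 :=
    mul_ne_zero (by simpa [Subtype.ext_iff] using hf0) (by simpa [Subtype.ext_iff] using hg0)
  simpa [Subtype.ext_iff] using h

/-- The complement of a hypersurface is dense. -/
theorem zariskiClosure_ne_zero {q : V → ℂ} (hq : q ∈ polyFun V) (hq0 : q ≠ 0) (v : V) :
    v ∈ zariskiClosure {v | q v ≠ 0} := fun f hf hz => by
  by_contra h
  refine polyFun_mul_ne_zero hf hq (fun h0 => h (congrFun h0 v)) hq0 (funext fun w => ?_)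
  by_cases hw : q w = 0
  · simp [hw]
  · simp [hz w hw]

end CoordinateRings

/-! ### Point derivations and transcendence bases -/

section PointDerivations

/-- A tangent vector at the `ℂ`-point `ev` of a `ℂ`-algebra. -/
def IsPointDerivation {A : Type*} [CommRing A] [Algebra ℂ A] (ev : A →ₐ[ℂ] ℂ) (D : A →ₗ[ℂ] ℂ) :
    Prop := ∀ f g, D (f * g) = D f * ev g + ev f * D g

variable {A : Type*} [CommRing A] [Algebra ℂ A] {ev : A →ₐ[ℂ] ℂ} {D : A →ₗ[ℂ] ℂ}

theorem IsPointDerivation.map_algebraMap (hD : IsPointDerivation ev D) (c : ℂ) :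
    D (algebraMap ℂ A c) = 0 := by
  have h1 : D 1 = 0 := by
    have := hD 1 1
    simp only [mul_one, map_one, one_mul] at this
    simpa using this
  rw [Algebra.algebraMap_eq_smul_one, map_smul, h1, smul_zero]

theorem IsPointDerivation.eq_zero_of_mem_adjoin (hD : IsPointDerivation ev D) {s : Set A}
    (hs : ∀ a ∈ s, D a = 0) {a : A} (ha : a ∈ Algebra.adjoin ℂ s) : D a = 0 := by
  induction ha using Algebra.adjoin_induction with
  | mem a ha => exact hs a ha
  | algebraMap r => exact hD.map_algebraMap r
  | add f g _ _ hf hg => rw [map_add, hf, hg, add_zero]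
  | mul f g _ _ hf hg => rw [hD, hf, hg, zero_mul, mul_zero, add_zero]

theorem IsPointDerivation.map_pow_succ (hD : IsPointDerivation ev D) (a : A) (n : ℕ) :
    D (a ^ (n + 1)) = (n + 1) * ev a ^ n * D a := by
  induction n with
  | zero => simp
  | succ n ih =>
    rw [pow_succ, hD, ih, map_pow]
    push_cast
    ring

/-- The chain rule for a polynomial whose coefficients are constants for `D`. Applied to an
algebraic equation of `a`, it determines `D a` wherever the derivative of the equation does not
vanish. -/
theorem IsPointDerivation.map_aeval (hD : IsPointDerivation ev D) {S : Subalgebra ℂ A}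
    (hS : ∀ a ∈ S, D a = 0) (p : Polynomial S) (a : A) :
    D (Polynomial.aeval a p) = ev (Polynomial.aeval a (Polynomial.derivative p)) * D a := by
  induction p using Polynomial.induction_on' with
  | add p q hp hq => simp only [map_add, hp, hq, add_mul]
  | monomial n c =>
    rw [Polynomial.aeval_monomial, Polynomial.derivative_monomial, Polynomial.aeval_monomial, hD]
    have hc : D (algebraMap S A c) = 0 := hS _ c.2
    cases n with
    | zero =>
      have h1 := hD.map_algebraMap 1
      rw [map_one] at h1
      simp only [pow_zero, h1, hc, mul_zero, zero_mul, add_zero, Nat.cast_zero, map_zero]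
    | succ n =>
      rw [hc, hD.map_pow_succ, zero_mul, zero_add]
      simp only [map_mul, map_pow, Nat.add_sub_cancel, Nat.cast_add, Nat.cast_one, map_add,
        map_natCast, map_one]
      ring

/-- An annihilating polynomial of least degree works: in characteristic zero its derivative is
nonzero of smaller degree, so it cannot annihilate `a`. -/
theorem exists_aeval_derivative_ne_zero [IsDomain A] {S : Subalgebra ℂ A} {a : A}
    (ha : IsAlgebraic S a) : ∃ p : Polynomial S, Polynomial.aeval a p = 0 ∧
      Polynomial.aeval a (Polynomial.derivative p) ≠ 0 := by
  obtain ⟨p, ⟨hp0, hpa⟩, hmin⟩ := WellFounded.has_min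
    (measure (Polynomial.natDegree : Polynomial S → ℕ)).wf
    {p | p ≠ 0 ∧ Polynomial.aeval a p = 0} ha
  refine ⟨p, hpa, fun h => ?_⟩
  have : CharZero S := charZero_of_injective_algebraMap (algebraMap ℂ S).injective
  have hdeg : p.natDegree ≠ 0 := fun h0 => by
    rw [Polynomial.eq_C_of_natDegree_eq_zero h0, Polynomial.aeval_C] at hpa
    refine hp0 ?_
    rw [Polynomial.eq_C_of_natDegree_eq_zero h0, (Subtype.ext hpa : p.coeff 0 = 0), map_zero]
  refine hmin (Polynomial.derivative p) ⟨fun h0 => hdeg ?_, h⟩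
    (Polynomial.natDegree_derivative_lt hdeg)
  exact Polynomial.derivative_eq_zero.1 h0

/-- At a general point, a tangent vector is determined by its values on a transcendence basis. -/
theorem exists_ne_zero_forall_pointDerivation [IsDomain A] [Algebra.FiniteType ℂ A] {s : Set A}
    (hs : Algebra.IsAlgebraic (Algebra.adjoin ℂ s) A) :
    ∃ a : A, a ≠ 0 ∧ ∀ (ev : A →ₐ[ℂ] ℂ) (D : A →ₗ[ℂ] ℂ), IsPointDerivation ev D → ev a ≠ 0 →
      (∀ x ∈ s, D x = 0) → D = 0 := by
  obtain ⟨t, ht⟩ := (Algebra.FiniteType.out : (⊤ : Subalgebra ℂ A).FG)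
  choose p hp hp' using fun x : A => exists_aeval_derivative_ne_zero (hs.isAlgebraic x)
  -- The excluded hypersurface is where one of the finitely many generators is a multiple root of
  -- its chosen equation over the subalgebra generated by `s`.
  refine ⟨∏ x ∈ t, Polynomial.aeval x (Polynomial.derivative (p x)),
    Finset.prod_ne_zero_iff.2 fun x _ => hp' x, fun ev D hD hev hDs => ?_⟩
  rw [map_prod, Finset.prod_ne_zero_iff] at hev
  ext a
  refine hD.eq_zero_of_mem_adjoin (s := t) (fun x hx => ?_) (ht ▸ Algebra.mem_top)
  have h := hD.map_aeval (S := Algebra.adjoin ℂ s) (fun y hy => hD.eq_zero_of_mem_adjoin hDs hy)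
    (p x) x
  rw [hp, map_zero, eq_comm] at h
  exact (mul_eq_zero.1 h).resolve_left (hev x hx)

end PointDerivations

/-! ### Generic smoothness of a dominant polynomial map -/

section GenericTangent

variable {V P : Type*} [AddCommGroup V] [Module ℂ V] [AddCommGroup P] [Module ℂ P]

theorem restrict_mem_coordRing (Y : Set V) {f : V → ℂ} (hf : f ∈ polyFun V) :
    (fun y : Y => f y) ∈ coordRing Y := by
  induction hf using Algebra.adjoin_induction with
  | mem f hf =>
    obtain ⟨ψ, rfl⟩ := hf
    exact Algebra.subset_adjoin ⟨ψ, rfl⟩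
  | algebraMap r => exact (coordRing Y).algebraMap_mem r
  | add f g _ _ hf hg => exact (coordRing Y).add_mem hf hg
  | mul f g _ _ hf hg => exact (coordRing Y).mul_mem hf hg

/-- Restriction of polynomial functions to `Y`. -/
def restrictHom (Y : Set V) : polyFun V →ₐ[ℂ] coordRing Y where
  toFun f := ⟨fun y => f.1 y, restrict_mem_coordRing Y f.2⟩
  map_one' := rfl
  map_mul' _ _ := rfl
  map_zero' := rfl
  map_add' _ _ := rfl
  commutes' _ := rfl

theorem restrictHom_surjective (Y : Set V) : Function.Surjective (restrictHom Y) := by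
  rintro ⟨f, hf⟩
  induction hf using Algebra.adjoin_induction with
  | mem f hf =>
    obtain ⟨ψ, rfl⟩ := hf
    exact ⟨⟨_, dual_mem_polyFun ψ⟩, rfl⟩
  | algebraMap r => exact ⟨algebraMap ℂ _ r, rfl⟩
  | add f g _ _ hf hg =>
    obtain ⟨F, hF⟩ := hf
    obtain ⟨G, hG⟩ := hg
    exact ⟨F + G, by rw [map_add, hF, hG]; rfl⟩
  | mul f g _ _ hf hg =>
    obtain ⟨F, hF⟩ := hf
    obtain ⟨G, hG⟩ := hg
    exact ⟨F * G, by rw [map_mul, hF, hG]; rfl⟩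

/-- Evaluation at a point of `Y`. -/
def evalHom {Y : Set V} (y : Y) : coordRing Y →ₐ[ℂ] ℂ :=
  (Pi.evalAlgHom ℂ (fun _ : Y => ℂ) y).comp (coordRing Y).val

/-- Evaluation of polynomial functions at a point. -/
def evalPolyHom (x : V) : polyFun V →ₐ[ℂ] ℂ :=
  (Pi.evalAlgHom ℂ (fun _ : V => ℂ) x).comp (polyFun V).val

/-- The derivative at `x` in the direction `v`. -/
def polyDerivation (x v : V) : polyFun V →ₗ[ℂ] ℂ where
  toFun f := differential f.2 x v
  map_add' f g := differential_add f.2 g.2 x v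
  map_smul' c f := differential_smul c f.2 x v

theorem isPointDerivation_polyDerivation (x v : V) :
    IsPointDerivation (evalPolyHom x) (polyDerivation x v) := fun f g =>
  differential_mul f.2 g.2 x v

theorem polyDerivation_congr {Y : Set V} {x v : V} (hv : v ∈ tangentSpace Y x) {f g : polyFun V}
    (h : restrictHom Y f = restrictHom Y g) : polyDerivation x v f = polyDerivation x v g := by
  rw [← sub_eq_zero, ← map_sub]
  refine mem_tangentSpace.1 hv _ (f - g).2 fun z hz => sub_eq_zero.2 ?_
  exact congrFun (congrArg Subtype.val h) ⟨z, hz⟩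

/-- The derivation of the coordinate ring of `Y` defined by a tangent vector. -/
def tangentDerivation (Y : Set V) (x : V) (v : tangentSpace Y x) : coordRing Y →ₗ[ℂ] ℂ where
  toFun f := polyDerivation x v (Function.surjInv (restrictHom_surjective Y) f)
  map_add' f g := by
    rw [← map_add]
    refine polyDerivation_congr v.2 ?_
    rw [map_add]
    simp only [Function.surjInv_eq]
  map_smul' c f := by
    rw [RingHom.id_apply, ← map_smul]
    refine polyDerivation_congr v.2 ?_
    rw [map_smul]
    simp only [Function.surjInv_eq]

theorem tangentDerivation_restrictHom {Y : Set V} {x : V} (v : tangentSpace Y x)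
    (f : polyFun V) : tangentDerivation Y x v (restrictHom Y f) = polyDerivation x v f :=
  polyDerivation_congr v.2 (Function.surjInv_eq _ _)

theorem isPointDerivation_tangentDerivation {Y : Set V} (x : Y) (v : tangentSpace Y (x : V)) :
    IsPointDerivation (evalHom x) (tangentDerivation Y x v) := fun f g => by
  obtain ⟨f, rfl⟩ := restrictHom_surjective Y f
  obtain ⟨g, rfl⟩ := restrictHom_surjective Y g
  rw [← map_mul]
  simp only [tangentDerivation_restrictHom]
  exact isPointDerivation_polyDerivation (x : V) v f g

variable {φ : P → V} (hφ : IsPolyMap φ) {Y : Set V}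

/-- Pulling back along a polynomial map. -/
def pullbackHom (hY : ∀ t, φ t ∈ Y) : coordRing Y →ₐ[ℂ] polyFun P where
  toFun f := ⟨fun t => f.1 ⟨φ t, hY t⟩, by
    obtain ⟨f, rfl⟩ := restrictHom_surjective Y f
    exact hφ.comp_mem f.2⟩
  map_one' := rfl
  map_mul' _ _ := rfl
  map_zero' := rfl
  map_add' _ _ := rfl
  commutes' _ := rfl

theorem pullbackHom_injective (hY : ∀ t, φ t ∈ Y) (hY' : Y ⊆ zariskiClosure (Set.range φ)) :
    Function.Injective (pullbackHom hφ hY) := by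
  rw [injective_iff_map_eq_zero]
  intro f hf
  obtain ⟨F, rfl⟩ := restrictHom_surjective Y f
  refine Subtype.ext (funext fun y => hY' y.2 _ F.2 ?_)
  rintro _ ⟨t, rfl⟩
  exact congrFun (congrArg Subtype.val hf) t

/-- A transcendence basis `s` of the coordinate ring of `Y` pulls back to an algebraically
independent set and extends to a transcendence basis `T` of the polynomial functions on `P`, with
`dim P` elements. At a general `t`, derivations on either side are determined by their values on `T`
and on `s`. Counting dimensions, all values on `T` are attained by directions in `P`, so pushing
forward attains all values on `s`, and the tangent space is identified with the functions on `s`.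
The last clause says that `v` is the image of `w` under the differential of `φ`, tested on linear
forms. -/
theorem exists_generic_tangentSpace [FiniteDimensional ℂ V] [FiniteDimensional ℂ P]
    (hY : ∀ t, φ t ∈ Y) (hY' : Y ⊆ zariskiClosure (Set.range φ)) :
    ∃ q ∈ polyFun P, q ≠ 0 ∧ ∀ t, q t ≠ 0 →
      (finrank ℂ (tangentSpace Y (φ t)) : Cardinal) = Algebra.trdeg ℂ (coordRing Y) ∧
      ∀ v ∈ tangentSpace Y (φ t), ∃ w, ∀ ψ : Dual ℂ V, ψ v = differential (hφ ψ) t w := by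
  have hinj := pullbackHom_injective hφ hY hY'
  have : IsDomain (coordRing Y) := hinj.isDomain (pullbackHom hφ hY).toRingHom
  have : Algebra.FiniteType ℂ (coordRing Y) :=
    Algebra.FiniteType.of_surjective (restrictHom Y) (restrictHom_surjective Y)
  have : FaithfulSMul ℂ (coordRing Y) :=
    (faithfulSMul_iff_algebraMap_injective ℂ (coordRing Y)).2 (algebraMap ℂ (coordRing Y)).injective
  obtain ⟨s, hs⟩ := exists_isTranscendenceBasis ℂ (coordRing Y)
  have hs' : AlgebraicIndependent ℂ (Subtype.val :
      (pullbackHom hφ hY '' s : Set _) → polyFun P) := by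
    have h := (hs.1.map' (f := pullbackHom hφ hY) hinj).coe_range
    have h2 : Set.range (pullbackHom hφ hY ∘ (Subtype.val : s → coordRing Y)) =
        pullbackHom hφ hY '' s := by
      rw [Set.range_comp, Subtype.range_coe]
    rwa [h2] at h
  obtain ⟨T, hsT, hT⟩ := exists_isTranscendenceBasis_superset hs'
  have hTc := hT.cardinalMk_eq_trdeg
  have hsc := hs.cardinalMk_eq_trdeg
  rw [trdeg_polyFun] at hTc
  have hTfin : Finite T := by
    rw [← Cardinal.lt_aleph0_iff_finite, hTc]
    exact Cardinal.natCast_lt_aleph0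
  have hsfin : Finite s := by
    have h1 : (pullbackHom hφ hY '' s).Finite := Set.Finite.subset hTfin hsT
    exact Set.Finite.of_finite_image h1 hinj.injOn
  have := Fintype.ofFinite T
  have := Fintype.ofFinite s
  have hTcard : finrank ℂ P = finrank ℂ (T → ℂ) := by
    rw [Module.finrank_fintype_fun_eq_card]
    rw [Cardinal.mk_fintype] at hTc
    exact_mod_cast hTc.symm
  have halgT := hT.isAlgebraic
  rw [Subtype.range_coe] at halgT
  have halgs := hs.isAlgebraic
  rw [Subtype.range_coe] at halgs
  obtain ⟨a, ha0, ha⟩ := exists_ne_zero_forall_pointDerivation halgT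
  obtain ⟨b, hb0, hb⟩ := exists_ne_zero_forall_pointDerivation halgs
  -- Nonvanishing of the product makes `t` general in `P` and `φ t` general in `Y`.
  refine ⟨a.1 * (pullbackHom hφ hY b).1, (polyFun P).mul_mem a.2 (Subtype.property _),
    polyFun_mul_ne_zero a.2 (Subtype.property _) (by simpa using ha0) ?_, fun t ht => ?_⟩
  · have : pullbackHom hφ hY b ≠ 0 := (map_ne_zero_iff _ hinj).2 hb0
    simpa using this
  have hat : evalPolyHom t a ≠ 0 := left_ne_zero_of_mul ht
  have hbt : evalHom (⟨φ t, hY t⟩ : Y) b ≠ 0 := right_ne_zero_of_mul ht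
  -- directions in the parameter space
  let α : P →ₗ[ℂ] T → ℂ := LinearMap.pi fun τ => differential τ.1.2 t
  have hα : Function.Surjective α := by
    refine (LinearMap.injective_iff_surjective_of_finrank_eq_finrank hTcard).1 ?_
    rw [injective_iff_map_eq_zero]
    intro w hw
    have h := ha _ (polyDerivation t w) (isPointDerivation_polyDerivation t w) hat
      fun x hx => congrFun hw ⟨x, hx⟩
    rw [← forall_dual_apply_eq_zero_iff ℂ]
    intro ψ
    rw [← differential_dual ψ t w]
    exact LinearMap.congr_fun h ⟨_, dual_mem_polyFun ψ⟩
  have hα' : ∀ c : s → ℂ, ∃ w, ∀ x : s, polyDerivation t w (pullbackHom hφ hY x) = c x := by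
    intro c
    classical
    -- The values are prescribed on the pulled-back part of `T`; on the rest of `T` they are free
    -- and set to 0.
    obtain ⟨w, hw⟩ := hα fun τ => if h : ∃ x : s, pullbackHom hφ hY x = τ then c h.choose else 0
    refine ⟨w, fun x => ?_⟩
    have h1 := congrFun hw ⟨pullbackHom hφ hY x, hsT ⟨x, x.2, rfl⟩⟩
    have h2 : ∃ y : s, pullbackHom hφ hY y = pullbackHom hφ hY x := ⟨x, rfl⟩
    rw [dif_pos h2, Subtype.ext (hinj h2.choose_spec)] at h1
    exact h1
  -- pushing directions forward
  have hpush : ∀ w : P, ∃ v : tangentSpace Y (φ t), ∀ f : coordRing Y,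
      tangentDerivation Y (φ t) v f = polyDerivation t w (pullbackHom hφ hY f) := by
    intro w
    -- By reflexivity, the functional sending `ψ` to the derivative of `ψ ∘ φ` along `w` is
    -- evaluation at a vector, which plays the role of the differential of `φ` applied to `w`.
    obtain ⟨v, hv⟩ := (evalEquiv ℂ V).surjective
      { toFun := fun ψ => differential (hφ ψ) t w
        map_add' := fun ψ χ => by
          rw [← differential_add]
        map_smul' := fun c ψ => by
          rw [RingHom.id_apply, smul_eq_mul, ← differential_smul] }
    have hv' : ∀ ψ : Dual ℂ V, differential (hφ ψ) t w = ψ v := fun ψ =>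
      (LinearMap.congr_fun hv ψ).symm
    have hvT : v ∈ tangentSpace Y (φ t) := by
      refine mem_tangentSpace.2 fun f hf hfY => ?_
      rw [← differential_comp hφ hf hv']
      have h0 : (fun t => f (φ t)) = fun _ => 0 := funext fun t => hfY _ (hY t)
      have : ∀ (g : P → ℂ) (hg : g ∈ polyFun P), g = (fun _ => 0) → differential hg t w = 0 := by
        rintro _ hg rfl
        exact differential_const 0 t w
      exact this _ _ h0
    refine ⟨⟨v, hvT⟩, fun f => ?_⟩
    obtain ⟨F, rfl⟩ := restrictHom_surjective Y f
    rw [tangentDerivation_restrictHom]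
    exact (differential_comp hφ F.2 hv').symm
  -- a tangent vector is determined by its values on the transcendence basis
  have hdet : ∀ (v v' : tangentSpace Y (φ t)),
      (∀ x ∈ s, tangentDerivation Y (φ t) v x = tangentDerivation Y (φ t) v' x) →
      v = v' := by
    intro v v' h
    have h1 := hb _ (tangentDerivation Y (φ t) v - tangentDerivation Y (φ t) v')
      (fun f g => by
        have e1 := isPointDerivation_tangentDerivation ⟨φ t, hY t⟩ v f g
        have e2 := isPointDerivation_tangentDerivation ⟨φ t, hY t⟩ v' f g
        simp only [LinearMap.sub_apply] at *
        rw [e1, e2]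
        ring) hbt fun x hx => sub_eq_zero.2 (h x hx)
    refine Subtype.ext (sub_eq_zero.1 ((forall_dual_apply_eq_zero_iff ℂ _).1 fun ψ => ?_))
    have h2 := LinearMap.congr_fun h1 (restrictHom Y ⟨_, dual_mem_polyFun ψ⟩)
    rw [LinearMap.sub_apply, tangentDerivation_restrictHom, tangentDerivation_restrictHom] at h2
    rw [map_sub, ← differential_dual ψ (φ t), ← differential_dual ψ (φ t)]
    exact h2
  let β : tangentSpace Y (φ t) →ₗ[ℂ] s → ℂ :=
    { toFun := fun v x => tangentDerivation Y (φ t) v x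
      map_add' := fun v v' => funext fun x => by
        obtain ⟨F, hF⟩ := restrictHom_surjective Y (x : coordRing Y)
        simp only [← hF, tangentDerivation_restrictHom, Pi.add_apply]
        exact map_add (differential F.2 (φ t)) _ _
      map_smul' := fun c v => funext fun x => by
        obtain ⟨F, hF⟩ := restrictHom_surjective Y (x : coordRing Y)
        simp only [← hF, tangentDerivation_restrictHom, Pi.smul_apply]
        exact map_smul (differential F.2 (φ t)) _ _ }
  have hβ : Function.Bijective β := by
    refine ⟨fun v v' h => hdet v v' fun x hx => congrFun h ⟨x, hx⟩, fun c => ?_⟩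
    obtain ⟨w, hw⟩ := hα' c
    obtain ⟨v, hv⟩ := hpush w
    exact ⟨v, funext fun x => (hv x).trans (hw x)⟩
  constructor
  · rw [(LinearEquiv.ofBijective β hβ).finrank_eq, Module.finrank_fintype_fun_eq_card,
      ← Cardinal.mk_fintype, hsc]
  · intro v hv
    obtain ⟨w, hw⟩ := hα' fun x => tangentDerivation Y (φ t) ⟨v, hv⟩ x
    obtain ⟨v', hv'⟩ := hpush w
    have h := hdet v' ⟨v, hv⟩ fun x hx => (hv' x).trans (hw ⟨x, hx⟩)
    refine ⟨w, fun ψ => ?_⟩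
    have h3 := hv' (restrictHom Y ⟨_, dual_mem_polyFun ψ⟩)
    rw [h, tangentDerivation_restrictHom] at h3
    rw [← differential_dual ψ (φ t)]
    exact h3

end GenericTangent

/-! ### Multilinear maps as polynomial functions -/

section Multilinear

variable {p : ℕ} {M : Fin p → Type*} [∀ i, AddCommGroup (M i)] [∀ i, Module ℂ (M i)]

theorem hasDerivAt_multilinear (g : MultilinearMap ℂ M ℂ) (h a : ∀ i, M i) :
    HasDerivAt (fun t : ℂ => g (h + t • a)) (∑ i, g (Function.update h i (a i))) 0 := by
  have key : ∀ (s : Finset (Fin p)) (h : ∀ i, M i),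
      HasDerivAt (fun t : ℂ => g (s.piecewise (h + t • a) h))
        (∑ i ∈ s, g (Function.update h i (a i))) 0 := by
    intro s
    induction s using Finset.induction_on with
    | empty => exact fun h => by simpa using hasDerivAt_const (0 : ℂ) (g h)
    | insert i s hi ih =>
      intro h
      -- Expanding slot `i` leaves two expressions varying only in the slots of `s`, the second at
      -- the modified base point; hence the induction is over all `h`.
      have h1 : ∀ t : ℂ, g ((insert i s).piecewise (h + t • a) h) =
          g (s.piecewise (h + t • a) h) +
            t * g (s.piecewise (Function.update h i (a i) + t • a)
              (Function.update h i (a i))) := by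
        intro t
        have e1 : (insert i s).piecewise (h + t • a) h =
            Function.update (s.piecewise (h + t • a) h) i (h i + t • a i) := by
          rw [Finset.piecewise_insert]
          rfl
        have e2 : Function.update (s.piecewise (h + t • a) h) i (h i) =
            s.piecewise (h + t • a) h := by
          rw [Function.update_eq_self_iff, Finset.piecewise_eq_of_notMem _ _ _ hi]
        have e3 : Function.update (s.piecewise (h + t • a) h) i (a i) =
            s.piecewise (Function.update h i (a i) + t • a) (Function.update h i (a i)) := by
          ext j
          by_cases hj : j = i
          · subst hj
            simp [hi]
          · by_cases hs : j ∈ s <;> simp [hj, hs]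
        rw [e1, g.map_update_add, g.map_update_smul, e2, e3, smul_eq_mul]
      simp_rw [h1]
      rw [Finset.sum_insert hi, add_comm]
      refine (ih h).add ?_
      have h2 := (hasDerivAt_id (0 : ℂ)).mul (ih (Function.update h i (a i)))
      refine h2.congr_deriv ?_
      simp only [id_eq, zero_smul, add_zero, one_mul, zero_mul, Finset.piecewise_same]
  simpa using key Finset.univ h

theorem multilinear_mem_polyFun [∀ i, FiniteDimensional ℂ (M i)] (g : MultilinearMap ℂ M ℂ) :
    (fun x => g x) ∈ polyFun (∀ i, M i) := by
  let b := fun i => finBasis ℂ (M i)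
  have h : (fun x => g x) = ∑ r : ∀ i, Fin (finrank ℂ (M i)),
      g (fun i => b i (r i)) •
        ∏ i, (fun x : ∀ i, M i => ((b i).coord (r i) ∘ₗ LinearMap.proj i) x) := by
    ext x
    conv_lhs => rw [← funext fun i => (b i).sum_repr (x i)]
    rw [g.map_sum]
    simp [g.map_smul_univ, mul_comm]
  rw [h]
  exact Subalgebra.sum_mem _ fun r _ => (polyFun _).smul_mem
    (Subalgebra.prod_mem _ fun i _ => dual_mem_polyFun _) _

end Multilinear

/-! ### The action of tuples of endomorphisms and orbit closures -/

section GroupAction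

variable {p : ℕ} {n : Fin p → ℕ}

/-- A tensor product of the spaces `ℂ^{n_i}`: a multilinear map sending the standard basis vectors
to a basis. -/
structure TensorModel (n : Fin p → ℕ) (V : Type*) [AddCommGroup V] [Module ℂ V] where
  /-- the universal multilinear map -/
  tmul : MultilinearMap ℂ (fun i => Fin (n i) → ℂ) V
  /-- the standard basis -/
  basis : Basis (∀ i, Fin (n i)) ℂ V
  basis_apply : ∀ J, basis J = tmul fun i => Pi.single (J i) 1

variable {V : Type*} [AddCommGroup V] [Module ℂ V] (τ : TensorModel n V)

namespace TensorModel

theorem multilinear_ext {W : Type*} [AddCommGroup W] [Module ℂ W]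
    {f g : MultilinearMap ℂ (fun i => Fin (n i) → ℂ) W}
    (h : ∀ J : ∀ i, Fin (n i), f (fun i => Pi.single (J i) 1) = g fun i => Pi.single (J i) 1) :
    f = g :=
  Basis.ext_multilinear (fun i => Pi.basisFun ℂ (Fin (n i))) fun J => by simpa using h J

/-- A tuple of endomorphisms acting on the tensor space. -/
def actLin (h : ∀ i, End ℂ (Fin (n i) → ℂ)) : End ℂ V :=
  τ.basis.constr ℂ fun J => τ.tmul fun i => h i (Pi.single (J i) 1)

theorem actLin_tmul (h : ∀ i, End ℂ (Fin (n i) → ℂ)) (x : ∀ i, Fin (n i) → ℂ) :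
    τ.actLin h (τ.tmul x) = τ.tmul fun i => h i (x i) := by
  have : (τ.actLin h).compMultilinearMap τ.tmul = τ.tmul.compLinearMap h :=
    multilinear_ext fun J => by
      rw [LinearMap.compMultilinearMap_apply, ← τ.basis_apply, actLin, Basis.constr_basis]
      rfl
  exact congrArg (fun f => f x) this

/-- The action of tuples of endomorphisms on the tensor space. -/
def act : (∀ i, End ℂ (Fin (n i) → ℂ)) →* End ℂ V where
  toFun := τ.actLin
  map_one' := τ.basis.ext fun J => by
    rw [τ.basis_apply, actLin_tmul]
    rfl
  map_mul' h k := τ.basis.ext fun J => by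
    rw [τ.basis_apply, Module.End.mul_apply, actLin_tmul, actLin_tmul, actLin_tmul]
    rfl

theorem act_tmul (h : ∀ i, End ℂ (Fin (n i) → ℂ)) (x : ∀ i, Fin (n i) → ℂ) :
    τ.act h (τ.tmul x) = τ.tmul fun i => h i (x i) :=
  τ.actLin_tmul h x

theorem act_mul_apply (h k : ∀ i, End ℂ (Fin (n i) → ℂ)) (y : V) :
    τ.act (h * k) y = τ.act h (τ.act k y) := by
  rw [map_mul, Module.End.mul_apply]

/-- The action on a fixed vector, as a multilinear map. -/
def actMul (y : V) : MultilinearMap ℂ (fun i => End ℂ (Fin (n i) → ℂ)) V :=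
  ∑ J, τ.basis.repr y J •
    τ.tmul.compLinearMap fun i => LinearMap.applyₗ (Pi.single (J i) (1 : ℂ) : Fin (n i) → ℂ)

theorem actMul_apply (y : V) (h : ∀ i, End ℂ (Fin (n i) → ℂ)) : τ.actMul y h = τ.act h y := by
  conv_rhs => rw [← τ.basis.sum_repr y, map_sum]
  simp only [actMul, sum_apply, smul_apply, map_smul, τ.basis_apply,
    act_tmul]
  rfl

/-- A linear form applied to the action on a fixed vector. -/
def actForm (ψ : Dual ℂ V) (y : V) : MultilinearMap ℂ (fun i => End ℂ (Fin (n i) → ℂ)) ℂ :=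
  ψ.compMultilinearMap (τ.actMul y)

theorem actForm_apply (ψ : Dual ℂ V) (y : V) (h : ∀ i, End ℂ (Fin (n i) → ℂ)) :
    τ.actForm ψ y h = ψ (τ.act h y) := congrArg ψ (τ.actMul_apply y h)

/-- The infinitesimal action on the factor `i`. -/
def actAt (i : Fin p) (A : End ℂ (Fin (n i) → ℂ)) : End ℂ V :=
  τ.act (Function.update 1 i A)

theorem act_update (i : Fin p) (h k : ∀ i, End ℂ (Fin (n i) → ℂ)) (hk : k * h = 1)
    (A : End ℂ (Fin (n i) → ℂ)) (y : V) :
    τ.act k (τ.act (Function.update h i A) y) = τ.actAt i (k i * A) y := by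
  rw [← τ.act_mul_apply, actAt]
  congr 2
  ext1 j
  by_cases hj : j = i
  · subst hj
    simp
  · simpa [hj] using congrFun hk j

/-- Since the action is linear in each factor, the infinitesimal direction is followed by an honest
line of translates; no exponential is needed. -/
theorem add_smul_actAt (i : Fin p) (A : End ℂ (Fin (n i) → ℂ)) (t : ℂ) (y : V) :
    y + t • τ.actAt i A y = τ.act (Function.update 1 i (1 + t • A)) y := by
  have h := (τ.actMul y).map_update_add 1 i 1 (t • A)
  have h1 : Function.update (1 : ∀ i, End ℂ (Fin (n i) → ℂ)) i 1 = 1 :=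
    Function.update_eq_self i 1
  rw [MultilinearMap.map_update_smul, h1] at h
  simp only [actMul_apply, map_one, Module.End.one_apply] at h
  exact h.symm

/-- Each `-h i` has finite spectrum, so only finitely many `t` are bad. Invertible tuples are thus
dense along lines, which passes closed conditions from invertible to all tuples. -/
theorem eventually_isUnit_add_smul (h : ∀ i, End ℂ (Fin (n i) → ℂ)) :
    ∀ᶠ t : ℂ in nhdsWithin 0 {0}ᶜ, IsUnit (h + t • 1) := by
  have h1 : ∀ i, ∀ᶠ t : ℂ in nhdsWithin 0 {0}ᶜ, IsUnit (h i + t • 1) := by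
    intro i
    have h2 := (Module.End.finite_spectrum (-h i)).compl_mem_cofinite
    have h3 : nhdsWithin (0 : ℂ) {0}ᶜ ≤ Filter.cofinite := nhdsNE_le_cofinite 0
    filter_upwards [h3 h2] with t ht
    have := spectrum.notMem_iff.1 ht
    rwa [sub_neg_eq_add, Algebra.algebraMap_eq_smul_one, add_comm] at this
  filter_upwards [Filter.eventually_all.2 h1] with t ht
  exact Pi.isUnit_iff.2 ht

theorem isPolyMap_act_left (y : V) :
    IsPolyMap fun h : ∀ i, End ℂ (Fin (n i) → ℂ) => τ.act h y := fun ψ => by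
  simpa only [actForm_apply] using multilinear_mem_polyFun (τ.actForm ψ y)

/-- A closed set stable under invertible tuples is stable under all tuples. -/
theorem act_mem_of_isZariskiClosed {Y : Set V} (hY : IsZariskiClosed Y)
    (hG : ∀ h, IsUnit h → ∀ y ∈ Y, τ.act h y ∈ Y) (h : ∀ i, End ℂ (Fin (n i) → ℂ))
    {y : V} (hy : y ∈ Y) : τ.act h y ∈ Y := by
  have h1 : IsZariskiClosed {h : ∀ i, End ℂ (Fin (n i) → ℂ) | τ.act h y ∈ Y} :=
    hY.preimage (τ.isPolyMap_act_left y)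
  exact mem_of_frequently_line (v := 1) h1
    ((eventually_isUnit_add_smul h).mono fun t ht => hG _ ht y hy).frequently

theorem actAt_mem_tangentSpace {Y : Set V} (hst : ∀ h, ∀ y ∈ Y, τ.act h y ∈ Y)
    {y : V} (hy : y ∈ Y) (i : Fin p) (A : End ℂ (Fin (n i) → ℂ)) :
    τ.actAt i A y ∈ tangentSpace Y y :=
  mem_tangentSpace_of_line fun t => by
    rw [add_smul_actAt]
    exact hst _ y hy

variable [FiniteDimensional ℂ V] (L : Submodule ℂ V)

theorem isPolyMap_act :
    IsPolyMap fun q : (∀ i, End ℂ (Fin (n i) → ℂ)) × L => τ.act q.1 (q.2 : V) := by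
  intro ψ
  let b := finBasis ℂ L
  have h : (fun q : (∀ i, End ℂ (Fin (n i) → ℂ)) × L => ψ (τ.act q.1 (q.2 : V))) =
      ∑ j, (fun q => (b.coord j ∘ₗ LinearMap.snd ℂ _ _) q) *
        fun q => τ.actForm ψ (b j : V) (LinearMap.fst ℂ _ _ q) := by
    ext q
    have h1 : (q.2 : V) = ∑ j, b.repr q.2 j • (b j : V) := by
      conv_lhs => rw [← b.sum_repr q.2, Submodule.coe_sum]
      rfl
    rw [h1]
    simp [actForm_apply]
  rw [h]
  exact Subalgebra.sum_mem _ fun j _ => (polyFun _).mul_mem (dual_mem_polyFun _)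
    ((isPolyMap_linearMap (LinearMap.fst ℂ (∀ i, End ℂ (Fin (n i) → ℂ)) L)).comp_mem
      (multilinear_mem_polyFun (τ.actForm ψ (b j : V))))

theorem differential_act (ψ : Dual ℂ V) (h a : ∀ i, End ℂ (Fin (n i) → ℂ))
    (l l' : L) : differential (τ.isPolyMap_act L ψ) (h, l) (a, l') =
      ψ (∑ i, τ.act (Function.update h i (a i)) (l : V) + τ.act h (l' : V)) := by
  refine (hasDerivAt_differential _ _ _).unique ?_
  have h1 := hasDerivAt_multilinear (τ.actForm ψ (l : V)) h a
  have h2 := (hasDerivAt_id (0 : ℂ)).mul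
    (hasDerivAt_multilinear (τ.actForm ψ (l' : V)) h a)
  refine ((h1.add h2).congr_deriv ?_).congr_of_eventuallyEq
    (Filter.Eventually.of_forall fun t => ?_)
  · simp [actForm_apply]
  · simp [actForm_apply]

theorem finrank_tangentSpace_act {Y : Set V} (hst : ∀ h, ∀ y ∈ Y, τ.act h y ∈ Y)
    {h : ∀ i, End ℂ (Fin (n i) → ℂ)} (hh : IsUnit h) (y : V) :
    finrank ℂ (tangentSpace Y (τ.act h y)) = finrank ℂ (tangentSpace Y y) := by
  have key : ∀ (h k : ∀ i, End ℂ (Fin (n i) → ℂ)) (y : V), k * h = 1 →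
      finrank ℂ (tangentSpace Y y) ≤ finrank ℂ (tangentSpace Y (τ.act h y)) := by
    intro h k y hk
    refine LinearMap.finrank_le_finrank_of_injective
      (f := (τ.act h).restrict fun v hv => map_mem_tangentSpace (τ.act h) (hst h) hv) ?_
    intro v w hvw
    have h1 : τ.act h (v : V) = τ.act h (w : V) := congrArg Subtype.val hvw
    have h2 := congrArg (τ.act k) h1
    rw [← τ.act_mul_apply, ← act_mul_apply, hk, map_one] at h2
    exact Subtype.ext h2
  obtain ⟨k, hk1, hk2⟩ := isUnit_iff_exists.1 hh
  refine le_antisymm ?_ (key h k y hk2)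
  have h1 := key k h (τ.act h y) hk1
  rwa [← act_mul_apply, hk2, map_one] at h1

theorem act_mem_regularPoints {Y : Set V} (hst : ∀ h, ∀ y ∈ Y, τ.act h y ∈ Y)
    {h : ∀ i, End ℂ (Fin (n i) → ℂ)} (hh : IsUnit h) {y : V}
    (hy : y ∈ regularPoints Y) : τ.act h y ∈ regularPoints Y :=
  ⟨hst h y hy.1, by rw [τ.finrank_tangentSpace_act hst hh]; exact hy.2⟩

/-- The general points of the orbit closure of a linear subspace `L` are regular, and the tangent
space is spanned by `L` and the infinitesimal action. -/
theorem exists_generic_orbit {Y : Set V} (hst : ∀ h, ∀ y ∈ Y, τ.act h y ∈ Y)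
    (hL : ∀ l ∈ L, l ∈ Y) (hY : Y ⊆ zariskiClosure {T | ∃ h, ∃ l ∈ L, T = τ.act h l}) :
    ∃ q ∈ polyFun L, q ≠ 0 ∧ ∀ l : L, q l ≠ 0 → (l : V) ∈ regularPoints Y ∧
      tangentSpace Y (l : V) ≤
        L ⊔ Submodule.span ℂ {v | ∃ i A, v = τ.actAt i A (l : V)} := by
  obtain ⟨Q, hQ, hQ0, hgen⟩ := exists_generic_tangentSpace (τ.isPolyMap_act L) (Y := Y)
    (fun t => hst _ _ (hL _ t.2.2)) (hY.trans (zariskiClosure_mono (by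
      rintro _ ⟨h, l, hl, rfl⟩
      exact ⟨(h, ⟨l, hl⟩), rfl⟩)))
  obtain ⟨⟨h₁, l₁⟩, hQ1⟩ := Function.ne_iff.1 hQ0
  -- Both conditions on `h` hold for all small nonzero `t` on the line through `h₁` in the direction
  -- of the identity tuple.
  obtain ⟨h, hQh, hh⟩ : ∃ h, Q (h, l₁) ≠ 0 ∧ IsUnit h := by
    have h1 : ∀ᶠ t : ℂ in nhds 0, Q ((h₁, l₁) + t • (1, 0)) ≠ 0 :=
      (continuousAt_line hQ (h₁, l₁) (1, 0)).eventually_ne (by simpa using hQ1)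
    obtain ⟨t, ht1, ht2⟩ :=
      ((h1.filter_mono nhdsWithin_le_nhds).and (eventually_isUnit_add_smul h₁)).exists
    exact ⟨h₁ + t • 1, by simpa using ht1, ht2⟩
  obtain ⟨k, hk1, hk2⟩ := isUnit_iff_exists.1 hh
  refine ⟨fun l => Q (h, l), ((isPolyMap_const h).prodMk
    (isPolyMap_linearMap LinearMap.id)).comp_mem hQ, Function.ne_iff.2 ⟨l₁, hQh⟩, fun l hl => ?_⟩
  obtain ⟨hrank, htan⟩ := hgen (h, l) hl
  refine ⟨⟨hL _ l.2, ?_⟩, fun v hv => ?_⟩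
  · rw [← hrank, τ.finrank_tangentSpace_act hst hh]
  -- The tangent space is known at the translate by `h`; applying the inverse `k` carries the
  -- description back to `l`.
  · obtain ⟨⟨a, l'⟩, hw⟩ := htan _ (map_mem_tangentSpace (τ.act h) (hst h) hv)
    have h1 : τ.act h v =
        ∑ i, τ.act (Function.update h i (a i)) (l : V) + τ.act h (l' : V) := by
      rw [← sub_eq_zero, ← forall_dual_apply_eq_zero_iff ℂ]
      intro ψ
      rw [map_sub, hw ψ, differential_act, sub_self]
    have h2 := congrArg (τ.act k) h1
    rw [map_add, map_sum, ← act_mul_apply, ← act_mul_apply, hk2, map_one] at h2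
    rw [show v = _ from h2]
    refine Submodule.add_mem _ (Submodule.sum_mem _ fun i _ => ?_)
      (Submodule.mem_sup_left l'.2)
    rw [τ.act_update i h k hk2]
    exact Submodule.mem_sup_right (Submodule.subset_span ⟨i, _, rfl⟩)

end TensorModel

end GroupAction

/-! ### Elimination for bilinear equations on a cone -/

section Elimination

open MvPolynomial

theorem aeval_apply_eq_eval {ι : Type*} (z : ι → ℂ) (p : MvPolynomial ι ℂ) :
    aeval z p = eval z p := rfl

theorem eval_smul_of_isHomogeneous {ι : Type*} {p : MvPolynomial ι ℂ} {d : ℕ}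
    (hp : p.IsHomogeneous d) (t : ℂ) (z : ι → ℂ) : eval (t • z) p = t ^ d * eval z p := by
  rw [eval_eq, eval_eq, Finset.mul_sum]
  refine Finset.sum_congr rfl fun m hm => ?_
  have h1 : m.degree = d := by
    by_contra h
    exact mem_support_iff.1 hm (hp.coeff_eq_zero h)
  simp only [Pi.smul_apply, smul_eq_mul, mul_pow, Finset.prod_mul_distrib,
    Finset.prod_pow_eq_pow_sum]
  rw [← h1, Finsupp.degree_apply]
  ring

/-- Along the line through `z` the value is a polynomial in `t` whose coefficients are the values of
the homogeneous components. It makes the vanishing ideal of a cone homogeneous. -/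
theorem eval_homogeneousComponent_eq_zero {ι : Type*} {p : MvPolynomial ι ℂ} {z : ι → ℂ}
    (h : ∀ t : ℂ, eval (t • z) p = 0) (d : ℕ) : eval z (homogeneousComponent d p) = 0 := by
  have h2 : (∑ i ∈ Finset.range (p.totalDegree + 1),
      Polynomial.C (eval z (homogeneousComponent i p)) * Polynomial.X ^ i) = 0 := by
    refine Polynomial.funext fun t => ?_
    have h3 := h t
    rw [← sum_homogeneousComponent p, map_sum] at h3
    simp only [Polynomial.eval_finsetSum, Polynomial.eval_mul, Polynomial.eval_C,
      Polynomial.eval_pow, Polynomial.eval_X, Polynomial.eval_zero]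
    rw [← h3]
    exact Finset.sum_congr rfl fun i _ => by
      rw [eval_smul_of_isHomogeneous (homogeneousComponent_isHomogeneous i p), mul_comm]
  by_cases hd : d ∈ Finset.range (p.totalDegree + 1)
  · have h3 := congrArg (fun q => q.coeff d) h2
    simpa [Polynomial.finsetSum_coeff, Finset.mem_range.1 hd] using h3
  · rw [homogeneousComponent_eq_zero _ _ (by simpa using hd), map_zero]

theorem homogeneousComponent_mul_of_isHomogeneous {ι : Type*} {f g : MvPolynomial ι ℂ} {i : ℕ}
    (hg : g.IsHomogeneous i) (d : ℕ) :
    homogeneousComponent (d + i) (f * g) = homogeneousComponent d f * g := by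
  conv_lhs => rw [← sum_homogeneousComponent f, Finset.sum_mul, map_sum]
  have h : ∀ j, homogeneousComponent (d + i) (homogeneousComponent j f * g) =
      if d = j then homogeneousComponent j f * g else 0 := fun j => by
    rw [homogeneousComponent_of_mem ((homogeneousComponent_isHomogeneous j f).mul hg)]
    simp only [Nat.add_right_cancel_iff]
  simp_rw [h]
  rw [Finset.sum_ite_eq]
  split_ifs with hd
  · rfl
  · rw [homogeneousComponent_eq_zero _ _ (by simpa using hd), zero_mul]

variable {E V : Type*} [AddCommGroup E] [Module ℂ E] [AddCommGroup V] [Module ℂ V]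

/-- Elimination for a family of bilinear equations on a closed cone, algebraic part: if the
equations at `y` have only the trivial solution in `X`, then all monomials of some positive degree
are, on `X`, combinations of the equations with homogeneous coefficients. -/
theorem exists_monomial_eq_sum {ι : Type*} [Finite ι] (e : Basis ι ℂ E) {X : Set E}
    (hX : IsZariskiClosed X) (hcone : ∀ t : ℂ, ∀ x ∈ X, t • x ∈ X) {J : Type*} (ℓ : J → Dual ℂ E)
    (h0 : ∀ x ∈ X, (∀ j, ℓ j x = 0) → x = 0) :
    ∃ D : ℕ, ∀ m : ι →₀ ℕ, m.degree = D + 1 → ∃ g : J →₀ MvPolynomial ι ℂ,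
      (∀ j, (g j).IsHomogeneous D) ∧ ∀ x ∈ X, eval (fun i => e.coord i x) (monomial m 1) =
        g.sum fun j P => eval (fun i => e.coord i x) P * ℓ j x := by
  have := Fintype.ofFinite ι
  let lin : J → MvPolynomial ι ℂ := fun j => ∑ i, C (ℓ j (e i)) * MvPolynomial.X i
  have hlin : ∀ j x, eval (fun i => e.coord i x) (lin j) = ℓ j x := fun j x => by
    conv_rhs => rw [← e.sum_repr x, map_sum]
    simp [lin, mul_comm]
  have hlinh : ∀ j, (lin j).IsHomogeneous 1 := fun j =>
    IsHomogeneous.sum _ _ _ fun i _ => by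
      simpa using (isHomogeneous_C ι (ℓ j (e i))).mul (isHomogeneous_X ℂ i)
  let I₀ : Ideal (MvPolynomial ι ℂ) := vanishingIdeal ℂ ((fun x i => e.coord i x) '' X)
  let I : Ideal (MvPolynomial ι ℂ) := I₀ ⊔ Ideal.span (Set.range lin)
  -- Nullstellensatz: a common zero of `I` is a point of the closed set `X` solving the equations,
  -- hence the origin.
  have hrad : idealOfVars ι ℂ ≤ I.radical := by
    rw [← vanishingIdeal_zeroLocus_eq_radical (K := ℂ), Ideal.span_le]
    rintro _ ⟨i, rfl⟩ z hz
    have hzx : ∀ k, e.coord k (∑ i, z i • e i) = z k := fun k =>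
      congrFun (e.repr_sum_self z) k
    have hz' : (fun k => e.coord k (∑ i, z i • e i)) = z := funext hzx
    have hzX : (∑ i, z i • e i) ∈ X := by
      refine hX fun f hf hfX => ?_
      obtain ⟨P, hP⟩ := (polyFunEquiv e).surjective ⟨f, hf⟩
      have hP' : ∀ x, f x = eval (fun i => e.coord i x) P := fun x => by
        rw [← polyFunEquiv_apply, hP]
      rw [hP', hz']
      have := hz P (Ideal.mem_sup_left (by
        rintro _ ⟨x, hx, rfl⟩
        rw [aeval_apply_eq_eval]
        exact (hP' x).symm.trans (hfX x hx)))
      rwa [aeval_apply_eq_eval] at this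
    have hz0 := h0 _ hzX fun j => by
      rw [← hlin, hz']
      have := hz (lin j) (Ideal.mem_sup_right (Ideal.subset_span ⟨j, rfl⟩))
      rwa [aeval_apply_eq_eval] at this
    rw [aeval_X, ← hzx i, hz0, map_zero]
  obtain ⟨D, hD⟩ := Ideal.exists_pow_le_of_le_radical_of_fg hrad (idealOfVars_fg ι ℂ)
  refine ⟨D, fun m hm => ?_⟩
  -- Degree `D` would suffice for membership; degree `D + 1` lets the coefficients of the linear
  -- forms have degree exactly `D`.
  have hmI : monomial m (1 : ℂ) ∈ I :=
    hD ((monomial_mem_pow_idealOfVars_iff D m one_ne_zero).2 (by omega))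
  obtain ⟨u, hu, w, hw, huw⟩ := Submodule.mem_sup.1 hmI
  obtain ⟨c, rfl⟩ := (Finsupp.mem_span_range_iff_exists_finsupp).1 hw
  refine ⟨c.mapRange (homogeneousComponent D) (map_zero _), fun j => ?_, fun x hx => ?_⟩
  · rw [Finsupp.mapRange_apply]
    exact homogeneousComponent_isHomogeneous D _
  have h1 : homogeneousComponent (D + 1) (monomial m (1 : ℂ)) = monomial m 1 :=
    homogeneousComponent_eq_self (isHomogeneous_monomial 1 hm)
  have h2 : eval (fun i => e.coord i x) (homogeneousComponent (D + 1) u) = 0 := by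
    refine eval_homogeneousComponent_eq_zero (fun t => ?_) _
    have := hu (fun i => e.coord i (t • x)) ⟨t • x, hcone t x hx, rfl⟩
    rw [aeval_apply_eq_eval] at this
    simp only [map_smul] at this
    exact this
  rw [← h1, ← huw, map_add, map_add, h2, zero_add,
    Finsupp.sum_mapRange_index (fun j => by simp), Finsupp.sum, Finsupp.sum, map_sum, map_sum]
  refine Finset.sum_congr rfl fun j _ => ?_
  rw [smul_eq_mul, homogeneousComponent_mul_of_isHomogeneous (hlinh j), map_mul, hlin]

/-- Nakayama's lemma for a finite family. -/
theorem exists_sub_one_mem_and_smul_eq_zero {R M κ σ : Type*} [CommRing R] [AddCommGroup M]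
    [Module R M] (I : Ideal R) [Finite κ] (m : κ → M)
    (h : ∀ k, ∃ (T : Finset σ) (r : σ → R) (x : σ → M), (∀ t, r t ∈ I) ∧
      (∀ t, x t ∈ Submodule.span R (Set.range m)) ∧ m k = ∑ t ∈ T, r t • x t) :
    ∃ r, r - 1 ∈ I ∧ ∀ k, r • m k = 0 := by
  obtain ⟨r, hr1, hr⟩ := Submodule.exists_sub_one_mem_and_smul_eq_zero_of_fg_of_le_smul I
    (Submodule.span R (Set.range m)) (Submodule.fg_span (Set.finite_range m)) (by
      refine Submodule.span_le.2 ?_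
      rintro _ ⟨k, rfl⟩
      obtain ⟨T, r, x, hr, hx, hk⟩ := h k
      rw [hk]
      exact Submodule.sum_mem _ fun t _ => Submodule.smul_mem_smul (hr t) (hx t))
  exact ⟨r, hr1, fun k => hr _ (Submodule.subset_span ⟨k, rfl⟩)⟩

/-- Elimination for bilinear equations on a closed cone. -/
theorem isZariskiClosed_elimination [FiniteDimensional ℂ E] {X : Set E}
    (hX : IsZariskiClosed X) (hcone : ∀ t : ℂ, ∀ x ∈ X, t • x ∈ X) {J : Type*}
    (b : J → E →ₗ[ℂ] V →ₗ[ℂ] ℂ) :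
    IsZariskiClosed {y | ∃ x ∈ X, x ≠ 0 ∧ ∀ j, b j x y = 0} := by
  intro y₀ hy₀
  by_contra hns
  let e := finBasis ℂ E
  obtain ⟨D, hD⟩ := exists_monomial_eq_sum e hX hcone (fun j => (b j).flip y₀) fun x hx h => by
    by_contra hx0
    exact hns ⟨x, hx, hx0, h⟩
  -- `Z` is the incidence set, and functions on it form a module over the polynomials in `y`.
  -- Nakayama's lemma is applied to the submodule spanned by the monomials of degree `D + 1` in `x`,
  -- at the maximal ideal of `y₀`.
  let Z := {q : E × V // q.1 ∈ X ∧ ∀ j, b j q.1 q.2 = 0}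
  let : Algebra (polyFun V) (Z → ℂ) := RingHom.toAlgebra
    { toFun := fun f z => f.1 z.1.2
      map_one' := rfl
      map_mul' := fun _ _ => rfl
      map_zero' := rfl
      map_add' := fun _ _ => rfl }
  have hsmul : ∀ (r : polyFun V) (F : Z → ℂ), r • F = fun z => r.1 z.1.2 * F z :=
    fun r F => Algebra.smul_def r F
  let mon : {m : Fin (finrank ℂ E) →₀ ℕ | m.degree = D + 1} → Z → ℂ := fun m z =>
    eval (fun i => e.coord i z.1.1) (monomial m.1 1)
  have hfin : Finite {m : Fin (finrank ℂ E) →₀ ℕ | m.degree = D + 1} :=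
    Finsupp.finite_of_degree_eq (D + 1)
  let N : Submodule (polyFun V) (Z → ℂ) := Submodule.span _ (Set.range mon)
  have hhom : ∀ P : MvPolynomial (Fin (finrank ℂ E)) ℂ, P.IsHomogeneous (D + 1) →
      (fun z : Z => eval (fun i => e.coord i z.1.1) P) ∈ N := by
    intro P hP
    have h1 : (fun z : Z => eval (fun i => e.coord i z.1.1) P) =
        ∑ m ∈ P.support, fun z : Z => eval (fun i => e.coord i z.1.1) (monomial m (coeff m P)) := by
      ext z
      conv_lhs => rw [P.as_sum, map_sum]
      rw [Finset.sum_apply]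
    rw [h1]
    refine Submodule.sum_mem _ fun m hm => ?_
    have hmd : m.degree = D + 1 := by
      by_contra h
      exact mem_support_iff.1 hm (hP.coeff_eq_zero h)
    have h2 : (fun z : Z => eval (fun i => e.coord i z.1.1) (monomial m (coeff m P))) =
        (algebraMap ℂ (polyFun V) (coeff m P)) • mon ⟨m, hmd⟩ := by
      rw [hsmul]
      ext z
      simp only [mon, eval_monomial, one_mul]
      rfl
    rw [h2]
    exact N.smul_mem _ (Submodule.subset_span ⟨_, rfl⟩)
  let I : Ideal (polyFun V) := RingHom.ker
    ((Pi.evalAlgHom ℂ (fun _ : V => ℂ) y₀).comp (polyFun V).val)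
  have hb : ∀ j c, (fun y => b j (e c) (y₀ - y)) ∈ polyFun V := fun j c => by
    simpa [sub_eq_add_neg] using
      (isPolyMap_const y₀).add (isPolyMap_linearMap (-LinearMap.id)) (b j (e c))
  obtain ⟨r, hr1, hr⟩ := exists_sub_one_mem_and_smul_eq_zero (σ := J × Fin (finrank ℂ E)) I mon (by
    rintro ⟨m, hm⟩
    obtain ⟨g, hg, hgX⟩ := hD m hm
    refine ⟨g.support ×ˢ Finset.univ, fun t => ⟨_, hb t.1 t.2⟩,
      fun t z => eval (fun i => e.coord i z.1.1) (MvPolynomial.X t.2 * g t.1), fun t => ?_,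
      fun t => hhom _ ?_, ?_⟩
    · show b t.1 (e t.2) (y₀ - y₀) = 0
      rw [sub_self, map_zero]
    · rw [add_comm]
      exact (isHomogeneous_X ℂ t.2).mul (hg t.1)
    ext z
    rw [Finset.sum_product]
    simp only [hsmul, Finset.sum_apply]
    refine (hgX z.1.1 z.2.1).trans (Finset.sum_congr rfl fun j _ => ?_)
    -- On `Z` the equation at `y₀` equals its difference from the vanishing equation at `y`, whose
    -- coefficients vanish at `y₀`. So each monomial lies in the ideal times the module.
    have h2 : b j z.1.1 y₀ = b j z.1.1 (y₀ - z.1.2) := by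
      rw [map_sub, z.2.2 j, sub_zero]
    have h3 : b j z.1.1 (y₀ - z.1.2) = ∑ c, e.repr z.1.1 c * b j (e c) (y₀ - z.1.2) := by
      conv_lhs => rw [← e.sum_repr z.1.1, map_sum]
      simp only [map_smul, LinearMap.sum_apply, LinearMap.smul_apply, smul_eq_mul]
    show eval (fun i => e.coord i z.1.1) (g j) * b j z.1.1 y₀ = _
    rw [h2, h3, Finset.mul_sum]
    refine Finset.sum_congr rfl fun c _ => ?_
    rw [map_mul, eval_X, Basis.coord_apply]
    ring)
  have hr0 : r.1 y₀ = 1 := sub_eq_zero.1 (show r.1 y₀ - 1 = 0 from hr1)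
  refine one_ne_zero (hr0.symm.trans (hy₀ r.1 r.2 ?_))
  rintro y ⟨x, hx, hx0, hxy⟩
  -- A nonzero solution over `y` has a nonzero coordinate; as `r` kills its power of degree `D + 1`,
  -- `r` vanishes at `y`. But `r` is 1 at `y₀`.
  obtain ⟨c, hc⟩ : ∃ c, e.repr x c ≠ 0 := by
    by_contra! h
    exact hx0 (e.repr.map_eq_zero_iff.1 (Finsupp.ext h))
  have h1 := congrFun (hr ⟨Finsupp.single c (D + 1), by simp⟩) ⟨(x, y), hx, hxy⟩
  rw [hsmul] at h1
  refine (mul_eq_zero.1 h1).resolve_right ?_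
  simp only [mon, eval_monomial, one_mul, Basis.coord_apply]
  rw [Finsupp.prod_single_index (h := fun i k => e.repr x i ^ k) (pow_zero _)]
  exact pow_ne_zero _ hc

end Elimination

/-! ### Product bilinear forms and rank-one tensors -/

section ProductForms

variable {p : ℕ} {n : Fin p → ℕ} {V : Type*} [AddCommGroup V] [Module ℂ V]

section BombieriWeyl

/-- `B` is the product of nondegenerate symmetric bilinear forms on the factors. -/
structure IsProductForm (τ : TensorModel n V) (β : ∀ i, LinearMap.BilinForm ℂ (Fin (n i) → ℂ))
    (B : LinearMap.BilinForm ℂ V) : Prop where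
  nondegenerate : ∀ i, (β i).Nondegenerate
  symm : ∀ i u v, β i u v = β i v u
  apply_tmul : ∀ x y, B (τ.tmul x) (τ.tmul y) = ∏ i, β i (x i) (y i)

/-- Coordinates are pairings with the dual basis. -/
theorem repr_eq_of_dualBasis {τ : TensorModel n V} {B : LinearMap.BilinForm ℂ V}
    {d : (∀ i, Fin (n i)) → V}
    (hd : ∀ J K, B (τ.basis J) (d K) = if J = K then 1 else 0) (x : V) (J : ∀ i, Fin (n i)) :
    τ.basis.repr x J = B x (d J) := by
  conv_rhs => rw [← τ.basis.sum_repr x, map_sum]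
  simp [hd]

namespace IsProductForm

variable {τ : TensorModel n V} {β : ∀ i, LinearMap.BilinForm ℂ (Fin (n i) → ℂ)}
  {B : LinearMap.BilinForm ℂ V} (hB : IsProductForm τ β B)

include hB

theorem comm (x y : V) : B x y = B y x := by
  have h : B = B.flip := LinearMap.ext_basis τ.basis τ.basis fun J K => by
    rw [B.flip_apply, τ.basis_apply, τ.basis_apply, hB.apply_tmul, hB.apply_tmul]
    exact Finset.prod_congr rfl fun i _ => hB.symm i _ _
  exact LinearMap.congr_fun (LinearMap.congr_fun h x) y

/-- Each tuple has an adjoint. -/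
theorem apply_act {h k : ∀ i, End ℂ (Fin (n i) → ℂ)}
    (hk : ∀ i u v, β i (h i u) v = β i u (k i v)) (x y : V) :
    B (τ.act h x) y = B x (τ.act k y) := by
  have h1 : B ∘ₗ τ.act h = B.compl₂ (τ.act k) := LinearMap.ext_basis τ.basis τ.basis fun J K => by
    rw [LinearMap.comp_apply, LinearMap.compl₂_apply, τ.basis_apply, τ.basis_apply, τ.act_tmul,
      τ.act_tmul, hB.apply_tmul, hB.apply_tmul]
    exact Finset.prod_congr rfl fun i _ => hk i _ _
  exact LinearMap.congr_fun (LinearMap.congr_fun h1 x) y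

theorem exists_adjoint (i : Fin p) (A : End ℂ (Fin (n i) → ℂ)) :
    ∃ A' : End ℂ (Fin (n i) → ℂ), ∀ u v, β i (A u) v = β i u (A' v) :=
  ⟨(β i).leftAdjointOfNondegenerate (hB.nondegenerate i) A, fun u v => by
    rw [hB.symm, hB.symm i u]
    exact ((β i).isAdjointPairLeftAdjointOfNondegenerate (hB.nondegenerate i) A v u).symm⟩

theorem exists_actAt_adjoint (i : Fin p) (A : End ℂ (Fin (n i) → ℂ)) :
    ∃ A' : End ℂ (Fin (n i) → ℂ), ∀ x y, B (τ.actAt i A x) y = B x (τ.actAt i A' y) := by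
  obtain ⟨A', hA'⟩ := hB.exists_adjoint i A
  refine ⟨A', fun x y => hB.apply_act (fun j u v => ?_) x y⟩
  by_cases hj : j = i
  · subst hj
    simpa using hA' u v
  · simp [hj]

/-- Each invertible tuple has a contragredient tuple. -/
theorem exists_contragredient {h : ∀ i, End ℂ (Fin (n i) → ℂ)} (hh : IsUnit h) :
    ∃ k, IsUnit k ∧ ∀ x y, B (τ.act h x) (τ.act k y) = B x y := by
  obtain ⟨g, hg1, hg2⟩ := isUnit_iff_exists.1 hh
  -- The contragredient is the adjoint of the inverse of `h`; the adjoint of `h` inverts it.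
  choose k hk using fun i => hB.exists_adjoint i (g i)
  choose l hl using fun i => hB.exists_adjoint i (h i)
  have hsep : ∀ i (v w : Fin (n i) → ℂ), (∀ u, β i u v = β i u w) → v = w := fun i v w h =>
    sub_eq_zero.1 ((hB.nondegenerate i).2 _ fun u => by rw [map_sub, h, sub_self])
  refine ⟨k, isUnit_iff_exists.2 ⟨l, ?_, ?_⟩, fun x y => ?_⟩
  · refine funext fun i => LinearMap.ext fun v => hsep i _ _ fun u => ?_
    have h1 : h i (g i u) = u := LinearMap.congr_fun (congrFun hg1 i) u
    show β i u (k i (l i v)) = β i u v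
    rw [← hk, ← hl, h1]
  · refine funext fun i => LinearMap.ext fun v => hsep i _ _ fun u => ?_
    have h1 : g i (h i u) = u := LinearMap.congr_fun (congrFun hg2 i) u
    show β i u (l i (k i v)) = β i u v
    rw [← hl, ← hk, h1]
  · rw [← hB.apply_act hk, ← τ.act_mul_apply, hg2, map_one, Module.End.one_apply]

theorem exists_dualBasis : ∃ d : (∀ i, Fin (n i)) → V,
    ∀ J K, B (τ.basis J) (d K) = if J = K then 1 else 0 := by
  refine ⟨fun K => τ.tmul fun i => (β i).dualBasis (hB.nondegenerate i)
    (Pi.basisFun ℂ (Fin (n i))) (K i), fun J K => ?_⟩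
  have h : ∀ i, β i (Pi.single (J i) 1) ((β i).dualBasis (hB.nondegenerate i)
      (Pi.basisFun ℂ (Fin (n i))) (K i)) = if J i = K i then 1 else 0 := fun i => by
    have := LinearMap.BilinForm.apply_dualBasis_right (hB.nondegenerate i) ⟨hB.symm i⟩
      (Pi.basisFun ℂ (Fin (n i))) (J i) (K i)
    rwa [Pi.basisFun_apply] at this
  rw [τ.basis_apply, hB.apply_tmul]
  simp_rw [h]
  rw [Fintype.prod_ite_zero]
  simp [funext_iff]

theorem eq_zero_of_forall_left {y : V} (h : ∀ x, B x y = 0) : y = 0 := by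
  obtain ⟨d, hd⟩ := hB.exists_dualBasis
  refine τ.basis.repr.map_eq_zero_iff.1 (Finsupp.ext fun J => ?_)
  have h1 := h (d J)
  rw [hB.comm, ← τ.basis.sum_repr y, map_sum] at h1
  simpa [hd] using h1

theorem ext_basis {y z : V} (h : ∀ J, B (τ.basis J) y = B (τ.basis J) z) : y = z := by
  refine sub_eq_zero.1 (hB.eq_zero_of_forall_left fun x => ?_)
  have : B.flip (y - z) = 0 := τ.basis.ext fun J => by
    rw [B.flip_apply, map_sub, h, sub_self, LinearMap.zero_apply]
  exact LinearMap.congr_fun this x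

end IsProductForm

end BombieriWeyl

section RankOne

variable (τ : TensorModel n V)

namespace TensorModel

theorem act_mem_range (h : ∀ i, End ℂ (Fin (n i) → ℂ)) :
    ∀ x ∈ Set.range τ.tmul, τ.act h x ∈ Set.range τ.tmul := by
  rintro _ ⟨u, rfl⟩
  exact ⟨_, (τ.act_tmul h u).symm⟩

theorem smul_mem_range (hp : 1 ≤ p) (t : ℂ) : ∀ x ∈ Set.range τ.tmul, t • x ∈ Set.range τ.tmul := by
  rintro _ ⟨u, rfl⟩
  refine ⟨Function.update u ⟨0, hp⟩ (t • u ⟨0, hp⟩), ?_⟩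
  rw [τ.tmul.map_update_smul, Function.update_eq_self]

theorem repr_tmul (u : ∀ i, Fin (n i) → ℂ) (J : ∀ i, Fin (n i)) :
    τ.basis.repr (τ.tmul u) J = ∏ i, u i (J i) := by
  have h : (τ.basis.coord J).compMultilinearMap τ.tmul =
      (MultilinearMap.mkPiAlgebra ℂ (Fin p) ℂ).compLinearMap
        fun i => LinearMap.proj (J i) := multilinear_ext fun K => by
    rw [LinearMap.compMultilinearMap_apply, ← τ.basis_apply, Basis.coord_apply,
      Basis.repr_self, MultilinearMap.compLinearMap_apply, MultilinearMap.mkPiAlgebra_apply,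
      Finsupp.single_apply]
    simp only [LinearMap.proj_apply, Pi.single_apply]
    rw [Fintype.prod_ite_zero]
    simp [funext_iff, eq_comm]
  exact congrArg (fun f => f u) h

/-- The exchange relations characterise tensors of rank at most one. -/
theorem mem_range_iff (hp : 1 ≤ p) (x : V) : x ∈ Set.range τ.tmul ↔
    ∀ q : (∀ i, Fin (n i)) × (∀ i, Fin (n i)) × Fin p,
      τ.basis.repr x q.1 * τ.basis.repr x q.2.1 =
        τ.basis.repr x (Function.update q.1 q.2.2 (q.2.1 q.2.2)) *
          τ.basis.repr x (Function.update q.2.1 q.2.2 (q.1 q.2.2)) := by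
  constructor
  · rintro ⟨u, rfl⟩ ⟨J, K, i⟩
    simp only [repr_tmul]
    rw [← Finset.prod_mul_distrib, ← Finset.prod_mul_distrib]
    refine Finset.prod_congr rfl fun j _ => ?_
    by_cases hj : j = i
    · subst hj
      simp [mul_comm]
    · simp [hj]
  · intro h
    by_cases hx : x = 0
    · exact ⟨0, by rw [hx, (τ.tmul).map_coord_zero ⟨0, hp⟩ rfl]⟩
    obtain ⟨J₀, hJ₀⟩ : ∃ J, τ.basis.repr x J ≠ 0 := by
      by_contra! h0
      exact hx (τ.basis.repr.map_eq_zero_iff.1 (Finsupp.ext h0))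
    -- Starting from an index with nonzero coordinate, exchanging one entry at a time factors every
    -- coordinate of `x`.
    have key : ∀ (J : ∀ i, Fin (n i)) (s : Finset (Fin p)),
        τ.basis.repr x (s.piecewise J J₀) = τ.basis.repr x J₀ *
          ∏ i ∈ s, (τ.basis.repr x (Function.update J₀ i (J i)) / τ.basis.repr x J₀) := by
      intro J s
      induction s using Finset.induction_on with
      | empty => simp
      | insert i s hi ih =>
        have h1 := h ((insert i s).piecewise J J₀, J₀, i)
        simp only [Finset.piecewise_insert, Function.update_idem, Function.update_self] at h1
        have h2 : Function.update (s.piecewise J J₀) i (J₀ i) = s.piecewise J J₀ := by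
          rw [Function.update_eq_self_iff, Finset.piecewise_eq_of_notMem _ _ _ hi]
        rw [h2, ih] at h1
        rw [Finset.prod_insert hi, Finset.piecewise_insert]
        refine mul_right_cancel₀ hJ₀ (h1.trans ?_)
        field_simp
    -- The factors are the normalised slices of `x` through `J₀`; one of them is rescaled to restore
    -- the overall constant.
    refine ⟨Function.update (fun i j => τ.basis.repr x (Function.update J₀ i j) /
      τ.basis.repr x J₀) ⟨0, hp⟩ (τ.basis.repr x J₀ •
        fun j => τ.basis.repr x (Function.update J₀ ⟨0, hp⟩ j) / τ.basis.repr x J₀), ?_⟩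
    refine τ.basis.repr.injective (Finsupp.ext fun J => ?_)
    rw [τ.tmul.map_update_smul, Function.update_eq_self_iff.2 rfl, map_smul, Finsupp.smul_apply,
      repr_tmul]
    have h3 := key J Finset.univ
    rw [Finset.piecewise_univ] at h3
    rw [h3, smul_eq_mul]

theorem isZariskiClosed_range (hp : 1 ≤ p) : IsZariskiClosed (Set.range τ.tmul) := by
  have h : Set.range τ.tmul = {x | ∀ q : (∀ i, Fin (n i)) × (∀ i, Fin (n i)) × Fin p,
      τ.basis.repr x q.1 * τ.basis.repr x q.2.1 =
        τ.basis.repr x (Function.update q.1 q.2.2 (q.2.1 q.2.2)) *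
          τ.basis.repr x (Function.update q.2.1 q.2.2 (q.1 q.2.2))} :=
    Set.ext fun x => τ.mem_range_iff hp x
  rw [h]
  have hc : ∀ J, (fun x => τ.basis.repr x J) ∈ polyFun V := fun J =>
    dual_mem_polyFun (τ.basis.coord J)
  exact isZariskiClosed_of_eqs (fun q => (polyFun V).mul_mem (hc _) (hc _))
    fun q => (polyFun V).mul_mem (hc _) (hc _)

theorem act_ne_zero {h : ∀ i, End ℂ (Fin (n i) → ℂ)} (hh : IsUnit h) {x : V} (hx : x ≠ 0) :
    τ.act h x ≠ 0 := by
  obtain ⟨k, -, hk⟩ := isUnit_iff_exists.1 hh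
  intro h0
  have h1 := congrArg (τ.act k) h0
  rw [← τ.act_mul_apply, hk, map_one, map_zero] at h1
  exact hx h1

variable [∀ i, NeZero (n i)]

/-- The base point `e_0 ⊗ ⋯ ⊗ e_0`. -/
def base : V := τ.tmul fun i => Pi.single (0 : Fin (n i)) 1

theorem base_eq : τ.base = τ.basis 0 := (τ.basis_apply 0).symm

theorem base_ne_zero : τ.base ≠ 0 := by
  rw [base_eq]
  exact τ.basis.ne_zero 0

theorem base_mem : τ.base ∈ Set.range τ.tmul := ⟨_, rfl⟩

theorem exists_act_base (u : ∀ i, Fin (n i) → ℂ) : ∃ h, τ.tmul u = τ.act h τ.base := by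
  refine ⟨fun i => (LinearMap.proj (0 : Fin (n i))).smulRight (u i), ?_⟩
  rw [base, τ.act_tmul]
  congr 1
  ext1 i
  simp

theorem exists_isUnit_act_base {x : V} (hx : x ∈ Set.range τ.tmul) (hx0 : x ≠ 0) :
    ∃ h, IsUnit h ∧ x = τ.act h τ.base := by
  obtain ⟨u, rfl⟩ := hx
  have h1 : ∀ i, ∃ h : End ℂ (Fin (n i) → ℂ), IsUnit h ∧ h (Pi.single 0 1) = u i := by
    intro i
    have hu : u i ≠ 0 := fun h => hx0 (τ.tmul.map_coord_zero i h)
    have hs : (Pi.single 0 1 : Fin (n i) → ℂ) ≠ 0 := by simp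
    obtain ⟨A, hA⟩ := SeparatingDual.exists_continuousLinearEquiv_apply_eq (R := ℂ) hs hu
    exact ⟨A.toLinearEquiv.toLinearMap, (Module.End.isUnit_iff _).2 A.bijective, hA⟩
  choose h hh hhu using h1
  refine ⟨h, Pi.isUnit_iff.2 hh, ?_⟩
  rw [base, τ.act_tmul]
  congr 1
  ext1 i
  exact (hhu i).symm

end TensorModel

end RankOne

end ProductForms

/-! ### The dual cone and its conormal variety -/

section Conormal

variable {p : ℕ} {n : Fin p → ℕ} {V : Type*} [AddCommGroup V] [Module ℂ V]

/-- The vanishing of the moment map: `y` is orthogonal to the infinitesimal orbit of `x`. -/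
def Moment (τ : TensorModel n V) (B : LinearMap.BilinForm ℂ V) (x y : V) : Prop :=
  ∀ i A, B (τ.actAt i A x) y = 0

theorem mem_conormal {B : LinearMap.BilinForm ℂ V} {X : Set V} {x y : V}
    (hx : x ∈ regularPoints X) (hy : y ∈ normalSpace B X x) : (x, y) ∈ conormal B X :=
  subset_zariskiClosure _ ⟨hx, hy⟩

/-- The union of the normal spaces to the nonzero tensors of rank one. -/
def dualCone (τ : TensorModel n V) (B : LinearMap.BilinForm ℂ V) : Set V :=
  {y | ∃ x ∈ Set.range τ.tmul, x ≠ 0 ∧ Moment τ B x y}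

namespace TensorModel

variable (τ : TensorModel n V)

theorem actAt_act {g h : ∀ i, End ℂ (Fin (n i) → ℂ)} (hg : h * g = 1) (i : Fin p)
    (A : End ℂ (Fin (n i) → ℂ)) (x : V) :
    τ.actAt i A (τ.act h x) = τ.act h (τ.actAt i (g i * A * h i) x) := by
  rw [actAt, actAt, ← τ.act_mul_apply, ← τ.act_mul_apply]
  congr 2
  ext1 j
  by_cases hj : j = i
  · subst hj
    have h1 : h j * g j = 1 := congrFun hg j
    simp only [Pi.mul_apply, Function.update_self]
    rw [← mul_assoc, ← mul_assoc, h1, one_mul]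
  · simp [hj]

theorem actAt_one (i : Fin p) (x : V) : τ.actAt i 1 x = x := by
  have h1 : Function.update (1 : ∀ i, End ℂ (Fin (n i) → ℂ)) i 1 = 1 :=
    Function.update_eq_self i 1
  rw [actAt, h1, map_one, Module.End.one_apply]

theorem tangentSpace_range_zero (hp : 1 ≤ p) : tangentSpace (Set.range τ.tmul) 0 = ⊤ := by
  rw [eq_top_iff, ← τ.basis.span_eq, Submodule.span_le]
  rintro _ ⟨J, rfl⟩
  refine mem_tangentSpace_of_line fun t => ?_
  rw [zero_add, τ.basis_apply]
  exact τ.smul_mem_range hp t _ ⟨_, rfl⟩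

section Generic

variable [∀ i, NeZero (n i)] [FiniteDimensional ℂ V]

/-- The nonzero tensors of rank one are regular, with tangent space the infinitesimal orbit. -/
theorem regular_range (hp : 1 ≤ p) {x : V} (hx : x ∈ Set.range τ.tmul) (hx0 : x ≠ 0) :
    x ∈ regularPoints (Set.range τ.tmul) ∧ tangentSpace (Set.range τ.tmul) x ≤
      Submodule.span ℂ {v | ∃ i A, v = τ.actAt i A x} := by
  let L : Submodule ℂ V := Submodule.span ℂ {τ.base}
  have hL : ∀ l ∈ L, l ∈ Set.range τ.tmul := fun l hl => by
    obtain ⟨t, rfl⟩ := Submodule.mem_span_singleton.1 hl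
    exact τ.smul_mem_range hp t _ τ.base_mem
  obtain ⟨q, hq, hq0, hgen⟩ := τ.exists_generic_orbit L τ.act_mem_range hL (by
    rintro _ ⟨u, rfl⟩
    obtain ⟨h, hh⟩ := τ.exists_act_base u
    exact subset_zariskiClosure _ ⟨h, _, Submodule.mem_span_singleton_self _, hh⟩)
  have hcoord : (fun l : L => (τ.basis.coord 0 ∘ₗ L.subtype) l) ≠ 0 :=
    Function.ne_iff.2 ⟨⟨τ.base, Submodule.mem_span_singleton_self _⟩, by simp [base_eq]⟩
  -- A point of the line that is both general and nonzero; it is then moved to `x` by an invertible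
  -- tuple.
  obtain ⟨l, hl⟩ := Function.ne_iff.1
    (polyFun_mul_ne_zero hq (dual_mem_polyFun _) hq0 hcoord)
  obtain ⟨hreg, htan⟩ := hgen l (left_ne_zero_of_mul hl)
  have hl0 : (l : V) ≠ 0 := fun h0 => right_ne_zero_of_mul hl (by
    show τ.basis.coord 0 (l : V) = 0
    rw [h0, map_zero])
  have htan' : tangentSpace (Set.range τ.tmul) (l : V) ≤
      Submodule.span ℂ {v | ∃ i A, v = τ.actAt i A (l : V)} := by
    refine htan.trans (sup_le ?_ le_rfl)
    -- The identity on one factor acts as the identity, so the line itself lies in the infinitesimal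
    -- orbit.
    have h1 : (l : V) ∈ Submodule.span ℂ {v | ∃ i A, v = τ.actAt i A (l : V)} :=
      Submodule.subset_span ⟨⟨0, hp⟩, 1, (τ.actAt_one _ _).symm⟩
    intro w hw
    obtain ⟨t, ht⟩ := Submodule.mem_span_singleton.1 l.2
    obtain ⟨s, rfl⟩ := Submodule.mem_span_singleton.1 hw
    have ht0 : t ≠ 0 := by
      rintro rfl
      exact hl0 (by rw [← ht, zero_smul])
    have h2 : s • τ.base = (s * t⁻¹) • (l : V) := by
      rw [← ht, smul_smul, mul_assoc, inv_mul_cancel₀ ht0, mul_one]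
    rw [h2]
    exact Submodule.smul_mem _ _ h1
  obtain ⟨h₁, hh₁, e₁⟩ := τ.exists_isUnit_act_base (hL _ l.2) hl0
  obtain ⟨h₂, hh₂, e₂⟩ := τ.exists_isUnit_act_base hx hx0
  obtain ⟨g₁, hg₁, hg₁'⟩ := isUnit_iff_exists.1 hh₁
  have hh : IsUnit (h₂ * g₁) := hh₂.mul (isUnit_iff_exists.2 ⟨h₁, hg₁', hg₁⟩)
  obtain ⟨g, hg, hg'⟩ := isUnit_iff_exists.1 hh
  have hx' : x = τ.act (h₂ * g₁) (l : V) := by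
    rw [e₂, e₁, ← τ.act_mul_apply, mul_assoc, hg₁', mul_one]
  refine ⟨hx' ▸ τ.act_mem_regularPoints τ.act_mem_range hh hreg, fun v hv => ?_⟩
  have h1 := map_mem_tangentSpace (τ.act g) (τ.act_mem_range g) hv
  rw [hx', ← τ.act_mul_apply, hg', map_one, Module.End.one_apply] at h1
  have h2 := Submodule.mem_map_of_mem (f := τ.act (h₂ * g₁)) (htan' h1)
  rw [← τ.act_mul_apply, hg, map_one, Module.End.one_apply, Submodule.map_span] at h2
  refine Submodule.span_mono ?_ h2
  rintro _ ⟨_, ⟨i, A, rfl⟩, rfl⟩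
  refine ⟨i, (h₂ * g₁) i * A * g i, ?_⟩
  rw [hx', τ.actAt_act hg]
  refine congrArg (fun C => τ.act (h₂ * g₁) (τ.actAt i C (l : V))) ?_
  have h3 : g i * (h₂ * g₁) i = 1 := congrFun hg' i
  calc A = (g i * (h₂ * g₁) i) * A * (g i * (h₂ * g₁) i) := by rw [h3, one_mul, mul_one]
    _ = g i * ((h₂ * g₁) i * A * g i) * (h₂ * g₁) i := by simp only [mul_assoc]

theorem mem_normalSpace_range (hp : 1 ≤ p) (B : LinearMap.BilinForm ℂ V) {x y : V}
    (hx : x ∈ Set.range τ.tmul) (hx0 : x ≠ 0) :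
    y ∈ normalSpace B (Set.range τ.tmul) x ↔ Moment τ B x y := by
  rw [normalSpace, LinearMap.BilinForm.mem_orthogonal_iff]
  constructor
  · exact fun h i A => h _ (τ.actAt_mem_tangentSpace τ.act_mem_range hx i A)
  · intro h v hv
    have h1 : Submodule.span ℂ {v | ∃ i A, v = τ.actAt i A x} ≤ LinearMap.ker (B.flip y) := by
      refine Submodule.span_le.2 ?_
      rintro _ ⟨i, A, rfl⟩
      exact h i A
    exact h1 ((τ.regular_range hp hx hx0).2 hv)

end Generic

end TensorModel

section DualCone

variable {τ : TensorModel n V} {β : ∀ i, LinearMap.BilinForm ℂ (Fin (n i) → ℂ)}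
  {B : LinearMap.BilinForm ℂ V}

theorem Moment.smul {x y : V} (h : Moment τ B x y) (t : ℂ) : Moment τ B (t • x) y := fun i A => by
  rw [map_smul, map_smul, LinearMap.smul_apply, h, smul_zero]

/-- The moment equations are bilinear and `x` runs over the nonzero points of a closed cone, so
elimination applies. -/
theorem isZariskiClosed_dualCone [FiniteDimensional ℂ V] (hp : 1 ≤ p) :
    IsZariskiClosed (dualCone τ B) := by
  have h := isZariskiClosed_elimination (τ.isZariskiClosed_range hp) (τ.smul_mem_range hp)
    (fun j : Σ i, End ℂ (Fin (n i) → ℂ) => B ∘ₗ τ.actAt j.1 j.2)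
  have h1 : dualCone τ B = {y | ∃ x ∈ Set.range τ.tmul, x ≠ 0 ∧
      ∀ j : Σ i, End ℂ (Fin (n i) → ℂ), (B ∘ₗ τ.actAt j.1 j.2) x y = 0} := by
    ext y
    refine exists_congr fun x => and_congr_right fun _ => and_congr_right fun _ => ?_
    exact ⟨fun h j => h j.1 j.2, fun h i A => h ⟨i, A⟩⟩
  rwa [h1]

theorem isZariskiClosed_moment [FiniteDimensional ℂ V] :
    IsZariskiClosed {q : V × V | Moment τ B q.1 q.2} := by
  have h1 : {q : V × V | Moment τ B q.1 q.2} = {q | ∀ j : Σ i, End ℂ (Fin (n i) → ℂ),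
      B (τ.actAt j.1 j.2 q.1) q.2 = 0} :=
    Set.ext fun q => ⟨fun h j => h j.1 j.2, fun h i A => h ⟨i, A⟩⟩
  rw [h1]
  exact isZariskiClosed_zeros fun j => bilin_mem_polyFun B
    (isPolyMap_linearMap (τ.actAt j.1 j.2 ∘ₗ LinearMap.fst ℂ V V))
    (isPolyMap_linearMap (LinearMap.snd ℂ V V))

theorem Moment.act {h k : ∀ i, End ℂ (Fin (n i) → ℂ)} (hh : IsUnit h)
    (hk : ∀ x y, B (τ.act h x) (τ.act k y) = B x y) {x y : V} (hxy : Moment τ B x y) :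
    Moment τ B (τ.act h x) (τ.act k y) := fun i A => by
  obtain ⟨g, hg, -⟩ := isUnit_iff_exists.1 hh
  rw [τ.actAt_act hg, hk, hxy]

theorem zero_mem_dualCone [∀ i, NeZero (n i)] : (0 : V) ∈ dualCone τ B :=
  ⟨τ.base, τ.base_mem, τ.base_ne_zero, fun _ _ => map_zero _⟩

namespace IsProductForm

variable (hB : IsProductForm τ β B)

include hB

theorem act_mem_dualCone_of_isUnit (k : ∀ i, End ℂ (Fin (n i) → ℂ)) (hk : IsUnit k) :
    ∀ y ∈ dualCone τ B, τ.act k y ∈ dualCone τ B := by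
  rintro y ⟨x, hx, hx0, hxy⟩
  obtain ⟨h, hh, hkh⟩ := hB.exists_contragredient hk
  exact ⟨τ.act h x, τ.act_mem_range h x hx, τ.act_ne_zero hh hx0,
    hxy.act hh fun x y => by rw [hB.comm, hkh, hB.comm]⟩

theorem act_mem_dualCone [FiniteDimensional ℂ V] (hp : 1 ≤ p) (h : ∀ i, End ℂ (Fin (n i) → ℂ)) :
    ∀ y ∈ dualCone τ B, τ.act h y ∈ dualCone τ B := fun _ hy =>
  τ.act_mem_of_isZariskiClosed (isZariskiClosed_dualCone hp) hB.act_mem_dualCone_of_isUnit h hy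

/-- The cone spans `V`, so its tangent space at the vertex is everything. Hence the vertex
contributes no nonzero normal vector, even when it is regular. -/
theorem normalSpace_range_zero (hp : 1 ≤ p) {y : V}
    (hy : y ∈ normalSpace B (Set.range τ.tmul) 0) : y = 0 := by
  rw [normalSpace, LinearMap.BilinForm.mem_orthogonal_iff, τ.tangentSpace_range_zero hp] at hy
  exact hB.eq_zero_of_forall_left fun x => hy x Submodule.mem_top

variable [∀ i, NeZero (n i)]

/-- Moving a point of the dual cone to the normal space at the base point. -/
theorem exists_act_of_moment {x y : V} (hx : x ∈ Set.range τ.tmul) (hx0 : x ≠ 0)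
    (hxy : Moment τ B x y) : ∃ h k l, IsUnit h ∧ IsUnit k ∧
      (∀ a b, B (τ.act h a) (τ.act k b) = B a b) ∧ x = τ.act h τ.base ∧ y = τ.act k l ∧
      Moment τ B τ.base l := by
  obtain ⟨h, hh, rfl⟩ := τ.exists_isUnit_act_base hx hx0
  obtain ⟨k, hk, hkh⟩ := hB.exists_contragredient hh
  obtain ⟨h', hh1, hh2⟩ := isUnit_iff_exists.1 hh
  obtain ⟨k', hk1, hk2⟩ := isUnit_iff_exists.1 hk
  refine ⟨h, k, τ.act k' y, hh, hk, hkh, rfl, ?_, ?_⟩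
  · rw [← τ.act_mul_apply, hk1, map_one, Module.End.one_apply]
  · have h1 := hxy.act (h := h') (k := k') (isUnit_iff_exists.2 ⟨h, hh2, hh1⟩) fun a b => by
      rw [← hkh, ← τ.act_mul_apply, ← τ.act_mul_apply, hh1, hk1, map_one, Module.End.one_apply,
        Module.End.one_apply]
    rwa [← τ.act_mul_apply, hh2, map_one, Module.End.one_apply] at h1

variable [FiniteDimensional ℂ V]

theorem conormal_range_subset (hp : 1 ≤ p) {q : V × V} (hq : q ∈ conormal B (Set.range τ.tmul)) :
    q.2 ∈ dualCone τ B := by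
  refine mem_of_mem_zariskiClosure (isZariskiClosed_dualCone hp)
    (isPolyMap_linearMap (LinearMap.snd ℂ V V)) ?_ hq
  rintro ⟨x, y⟩ ⟨hx, hy⟩
  by_cases hx0 : x = 0
  · subst hx0
    rw [LinearMap.snd_apply, hB.normalSpace_range_zero hp hy]
    exact zero_mem_dualCone
  · exact ⟨x, hx.1, hx0, (τ.mem_normalSpace_range hp B hx.1 hx0).1 hy⟩

theorem dualVariety_range (hp : 1 ≤ p) : dualVariety B (Set.range τ.tmul) = dualCone τ B := by
  refine Set.Subset.antisymm (zariskiClosure_minimal ?_ (isZariskiClosed_dualCone hp)) ?_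
  · rintro _ ⟨q, hq, rfl⟩
    exact hB.conormal_range_subset hp hq
  · rintro y ⟨x, hx, hx0, hxy⟩
    exact subset_zariskiClosure _ ⟨(x, y), mem_conormal
      (τ.regular_range hp hx hx0).1 ((τ.mem_normalSpace_range hp B hx hx0).2 hxy), rfl⟩

/-- The swapped conormal variety of the rank-one tensors lies in the conormal variety of the
dual. -/
theorem mem_conormal_dualCone (hp : 1 ≤ p) {x y : V} (hx : x ∈ Set.range τ.tmul) (hx0 : x ≠ 0)
    (hxy : Moment τ B x y) : (y, x) ∈ conormal B (dualCone τ B) := by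
  obtain ⟨L, hL⟩ : ∃ L : Submodule ℂ V, ∀ l, l ∈ L ↔ Moment τ B τ.base l :=
    ⟨normalSpace B (Set.range τ.tmul) τ.base, fun l =>
      τ.mem_normalSpace_range hp B τ.base_mem τ.base_ne_zero⟩
  obtain ⟨q, hq, hq0, hgen⟩ := τ.exists_generic_orbit L (hB.act_mem_dualCone hp)
    (fun l hl => ⟨τ.base, τ.base_mem, τ.base_ne_zero, (hL l).1 hl⟩) (by
      rintro z ⟨a, ha, ha0, haz⟩
      obtain ⟨h, k, l, -, -, -, -, rfl, hl⟩ := hB.exists_act_of_moment ha ha0 haz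
      exact subset_zariskiClosure _ ⟨k, l, (hL l).2 hl, rfl⟩)
  obtain ⟨h, k, l, hh, hk, hkh, rfl, rfl, hl⟩ := hB.exists_act_of_moment hx hx0 hxy
  obtain ⟨k', hk1, hk2⟩ := isUnit_iff_exists.1 hk
  have hφ : IsPolyMap fun l' : L => (τ.act k (l' : V), τ.act h τ.base) :=
    (isPolyMap_linearMap (τ.act k ∘ₗ L.subtype)).prodMk (isPolyMap_const (τ.act h τ.base))
  have hC : IsZariskiClosed (conormal B (dualCone τ B)) := isZariskiClosed_zariskiClosure _
  -- With `k` and `h` fixed, the pair depends polynomially on `l'`, so general points of `L` suffice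
  -- by density.
  suffices hmain : ∀ l' ∈ {l' : L | q l' ≠ 0},
      (τ.act k (l' : V), τ.act h τ.base) ∈ conormal B (dualCone τ B) by
    have hl' := zariskiClosure_ne_zero hq hq0 ⟨l, (hL l).2 hl⟩
    have h1 := mem_of_mem_zariskiClosure (V := L) (W := V × V) (C := conormal B (dualCone τ B))
      hC hφ hmain hl'
    exact h1
  intro l' hl'
  obtain ⟨hreg, htan⟩ := hgen l' hl'
  refine mem_conormal (τ.act_mem_regularPoints (hB.act_mem_dualCone hp) hk hreg) ?_
  rw [normalSpace, LinearMap.BilinForm.mem_orthogonal_iff]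
  intro v hv
  have h1 := map_mem_tangentSpace (τ.act k') (hB.act_mem_dualCone hp k') hv
  rw [← τ.act_mul_apply, hk2, map_one, Module.End.one_apply] at h1
  -- The base point is orthogonal to `L` by the moment condition for the identity, and to the
  -- infinitesimal orbit of `l'` by passing to adjoints.
  have h2 : L ⊔ Submodule.span ℂ {v | ∃ i A, v = τ.actAt i A (l' : V)} ≤
      LinearMap.ker (B τ.base) := by
    refine sup_le (fun w hw => ?_) (Submodule.span_le.2 ?_)
    · have := (hL w).1 hw ⟨0, hp⟩ 1
      rwa [τ.actAt_one] at this
    · rintro _ ⟨i, A, rfl⟩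
      obtain ⟨A', hA'⟩ := hB.exists_actAt_adjoint i A
      show B τ.base (τ.actAt i A (l' : V)) = 0
      rw [hB.comm, hA', hB.comm]
      exact (hL _).1 l'.2 i A'
  have h3 : B τ.base (τ.act k' v) = 0 := h2 (htan h1)
  rw [← hkh, ← τ.act_mul_apply, hk1, map_one, Module.End.one_apply, hB.comm] at h3
  exact h3

end IsProductForm

end DualCone

end Conormal

/-! ### Normal vectors of the dual cone have rank at most one -/

section NormalVectors

variable {p : ℕ} {n : Fin p → ℕ} {V : Type*} [AddCommGroup V] [Module ℂ V]

/-- Every linear form vanishing on the tangent space is the differential of an equation. -/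
theorem exists_gradient [FiniteDimensional ℂ V] {X : Set V} {x : V} {φ : Dual ℂ V}
    (h : ∀ v ∈ tangentSpace X x, φ v = 0) :
    ∃ f, ∃ hf : f ∈ polyFun V, (∀ z ∈ X, f z = 0) ∧ ∀ v, φ v = differential hf x v := by
  let W : Submodule ℂ (Dual ℂ V) :=
    { carrier := {ψ | ∃ f, ∃ hf : f ∈ polyFun V, (∀ z ∈ X, f z = 0) ∧
        ∀ v, ψ v = differential hf x v}
      zero_mem' := ⟨_, const_mem_polyFun 0, fun _ _ => rfl, fun v =>
        (differential_const 0 x v).symm⟩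
      add_mem' := by
        rintro _ _ ⟨f, hf, hf0, h1⟩ ⟨g, hg, hg0, h2⟩
        exact ⟨f + g, (polyFun V).add_mem hf hg, fun z hz => by simp [hf0 z hz, hg0 z hz],
          fun v => by rw [differential_add, LinearMap.add_apply, h1, h2]⟩
      smul_mem' := by
        rintro c _ ⟨f, hf, hf0, h1⟩
        exact ⟨c • f, (polyFun V).smul_mem hf c, fun z hz => by simp [hf0 z hz],
          fun v => by rw [differential_smul, LinearMap.smul_apply, h1, smul_eq_mul]⟩ }
  have hφ : φ ∈ W.dualCoannihilator.dualAnnihilator := by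
    rw [Submodule.mem_dualAnnihilator]
    intro v hv
    rw [Submodule.mem_dualCoannihilator] at hv
    exact h v (mem_tangentSpace.2 fun f hf hf0 => hv (differential hf x) ⟨f, hf, hf0, fun _ => rfl⟩)
  rw [Subspace.dualCoannihilator_dualAnnihilator_eq] at hφ
  exact hφ

namespace TensorModel

variable (τ : TensorModel n V)

/-- The infinitesimal action of a tuple of endomorphisms. -/
def der (A : ∀ i, End ℂ (Fin (n i) → ℂ)) : End ℂ V := ∑ i, τ.actAt i (A i)

theorem der_apply (A : ∀ i, End ℂ (Fin (n i) → ℂ)) (x : V) :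
    τ.der A x = ∑ i, τ.actAt i (A i) x := by
  rw [der, LinearMap.sum_apply]

theorem actAt_actAt (i : Fin p) (A C : End ℂ (Fin (n i) → ℂ)) (x : V) :
    τ.actAt i A (τ.actAt i C x) = τ.actAt i (A * C) x := by
  rw [actAt, actAt, actAt, ← τ.act_mul_apply]
  congr 2
  ext1 j
  by_cases hj : j = i
  · subst hj
    simp
  · simp [hj]

theorem actAt_comm {i j : Fin p} (hij : i ≠ j) (A : End ℂ (Fin (n i) → ℂ))
    (C : End ℂ (Fin (n j) → ℂ)) (x : V) :
    τ.actAt i A (τ.actAt j C x) = τ.actAt j C (τ.actAt i A x) := by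
  rw [actAt, actAt, ← τ.act_mul_apply, ← τ.act_mul_apply]
  congr 2
  ext1 k
  by_cases hi : k = i
  · subst hi
    simp [hij]
  · by_cases hj : k = j
    · subst hj
      simp [hi]
    · simp [hi, hj]

theorem actAt_tmul (i : Fin p) (A : End ℂ (Fin (n i) → ℂ)) (u : ∀ i, Fin (n i) → ℂ) :
    τ.actAt i A (τ.tmul u) = τ.tmul (Function.update u i (A (u i))) := by
  rw [actAt, act_tmul]
  congr 1
  ext1 j
  by_cases hj : j = i
  · subst hj
    simp
  · simp [hj]

variable [∀ i, NeZero (n i)]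

theorem der_base (A : ∀ i, End ℂ (Fin (n i) → ℂ)) : τ.der A τ.base =
    τ.tmul.linearDeriv (fun _ => Pi.single 0 1) fun i => A i (Pi.single 0 1) := by
  rw [der_apply, MultilinearMap.linearDeriv_apply]
  exact Finset.sum_congr rfl fun i _ => τ.actAt_tmul i (A i) _

/-- The endomorphism sending the first basis vector to `u` and the others to `0`. -/
def raise (u : ∀ i, Fin (n i) → ℂ) (i : Fin p) : End ℂ (Fin (n i) → ℂ) :=
  (LinearMap.proj 0).smulRight (u i)

theorem der_raise_base (u : ∀ i, Fin (n i) → ℂ) :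
    τ.der (raise u) τ.base = τ.tmul.linearDeriv (fun _ => Pi.single 0 1) u := by
  rw [der_base]
  congr 1
  ext1 i
  simp [raise]

theorem repr_actAt_raise (u : ∀ i, Fin (n i) → ℂ) (i : Fin p) (y : V) (J : ∀ i, Fin (n i)) :
    τ.basis.repr (τ.actAt i (raise u i) y) J =
      u i (J i) * τ.basis.repr y (Function.update J i 0) := by
  have h : τ.basis.coord J ∘ₗ τ.actAt i (raise u i) =
      u i (J i) • τ.basis.coord (Function.update J i 0) := τ.basis.ext fun K => by
    rw [LinearMap.comp_apply, LinearMap.smul_apply, Basis.coord_apply, Basis.coord_apply,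
      τ.basis_apply, actAt_tmul, repr_tmul, repr_tmul,
      ← Finset.mul_prod_erase Finset.univ _ (Finset.mem_univ i),
      ← Finset.mul_prod_erase Finset.univ _ (Finset.mem_univ i), smul_eq_mul, ← mul_assoc]
    refine congrArg₂ (· * ·) ?_ (Finset.prod_congr rfl fun j hj => ?_)
    · simp [raise, mul_comm]
    · have hj' := Finset.ne_of_mem_erase hj
      simp [hj']
  exact LinearMap.congr_fun h y

theorem repr_der_raise (u : ∀ i, Fin (n i) → ℂ) (y : V) (J : ∀ i, Fin (n i)) :
    τ.basis.repr (τ.der (raise u) y) J =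
      ∑ i, u i (J i) * τ.basis.repr y (Function.update J i 0) := by
  rw [der_apply, map_sum, Finsupp.finsetSum_apply]
  exact Finset.sum_congr rfl fun i _ => τ.repr_actAt_raise u i y J

theorem repr_base (J : ∀ i, Fin (n i)) : τ.basis.repr τ.base J = if J = 0 then 1 else 0 := by
  rw [base_eq, Basis.repr_self, Finsupp.single_apply]
  simp only [eq_comm]

theorem repr_der_raise_base_single (u : ∀ i, Fin (n i) → ℂ) {j : Fin p} {b : Fin (n j)}
    (hb : b ≠ 0) : τ.basis.repr (τ.der (raise u) τ.base) (Function.update 0 j b) = u j b := by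
  rw [repr_der_raise, Finset.sum_eq_single j]
  · rw [repr_base, Function.update_idem, Function.update_self,
      show Function.update (0 : ∀ i, Fin (n i)) j 0 = 0 from Function.update_eq_self j 0,
      if_pos rfl, mul_one]
  · intro i _ hij
    rw [repr_base, if_neg, mul_zero]
    intro h
    have h1 := congrFun h j
    rw [Function.update_of_ne (Ne.symm hij), Function.update_self] at h1
    exact hb h1
  · simp

/-- Each first-order term changes at most one entry of the base index, so no index with two nonzero
entries occurs. -/
theorem repr_der_raise_base_pair (u : ∀ i, Fin (n i) → ℂ) {i j : Fin p} (hij : i ≠ j)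
    {J : ∀ i, Fin (n i)} (hi : J i ≠ 0) (hj : J j ≠ 0) :
    τ.basis.repr (τ.der (raise u) τ.base) J = 0 := by
  rw [repr_der_raise]
  refine Finset.sum_eq_zero fun k _ => ?_
  rw [repr_base, if_neg, mul_zero]
  intro h
  by_cases hk : i = k
  · have h1 := congrFun h j
    rw [Function.update_of_ne (fun h => hij (hk.trans h.symm))] at h1
    exact hj h1
  · have h1 := congrFun h i
    rw [Function.update_of_ne hk] at h1
    exact hi h1

/-- The slots `i` and `j` can be raised in either order, whence the factor 2. Any other outer slot
leaves both nonzero entries to the inner derivative, which has no such coordinate. -/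
theorem repr_der_raise_der_raise (u : ∀ i, Fin (n i) → ℂ) {i j : Fin p} (hij : i ≠ j)
    {a : Fin (n i)} {b : Fin (n j)} (ha : a ≠ 0) (hb : b ≠ 0) :
    τ.basis.repr (τ.der (raise u) (τ.der (raise u) τ.base))
      (Function.update (Function.update 0 j b) i a) = 2 * (u i a * u j b) := by
  have hi : Function.update (Function.update (0 : ∀ i, Fin (n i)) j b) i a i = a :=
    Function.update_self ..
  have hj : Function.update (Function.update (0 : ∀ i, Fin (n i)) j b) i a j = b := by
    rw [Function.update_of_ne hij.symm, Function.update_self]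
  rw [repr_der_raise, Finset.sum_eq_add i j hij]
  · have e1 : Function.update (Function.update (Function.update (0 : ∀ i, Fin (n i)) j b) i a) i 0 =
        Function.update (0 : ∀ i, Fin (n i)) j b := by
      rw [Function.update_idem]
      exact Function.update_eq_self_iff.2
        (Function.update_of_ne hij b (0 : ∀ i, Fin (n i))).symm
    have e2 : Function.update (Function.update (Function.update (0 : ∀ i, Fin (n i)) j b) i a) j 0 =
        Function.update (0 : ∀ i, Fin (n i)) i a := by
      rw [Function.update_comm hij, Function.update_idem, Function.update_comm hij.symm]
      exact Function.update_eq_self_iff.2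
        (Function.update_of_ne hij.symm a (0 : ∀ i, Fin (n i))).symm
    rw [hi, hj, e1, e2, repr_der_raise_base_single _ _ hb, repr_der_raise_base_single _ _ ha]
    ring
  · rintro k - ⟨hki, hkj⟩
    rw [τ.repr_der_raise_base_pair u hij, mul_zero]
    · rwa [Function.update_of_ne hki.symm, hi]
    · rwa [Function.update_of_ne hkj.symm, hj]
  · simp
  · simp

/-- The hypothesis allows at most one factor `i₀` to leave the line of the first basis vector. Every
term of the Leibniz sum then varies only in slot `i₀`, and the sum collapses to one product. -/
theorem linearDeriv_mem_range (hp : 1 ≤ p) {u : ∀ i, Fin (n i) → ℂ}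
    (h : ∀ i j, i ≠ j → ∀ a b, a ≠ 0 → b ≠ 0 → u i a * u j b = 0) :
    τ.tmul.linearDeriv (fun _ => Pi.single 0 1) u ∈ Set.range τ.tmul := by
  obtain ⟨i₀, hi₀⟩ : ∃ i₀, ∀ i, i ≠ i₀ → ∀ a, a ≠ 0 → u i a = 0 := by
    by_cases h0 : ∃ i a, a ≠ 0 ∧ u i a ≠ 0
    · obtain ⟨i₀, a₀, ha₀, hu₀⟩ := h0
      exact ⟨i₀, fun i hi a ha => (mul_eq_zero.1 (h i i₀ hi a a₀ ha ha₀)).resolve_right hu₀⟩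
    · push Not at h0
      exact ⟨⟨0, hp⟩, fun i _ a ha => h0 i a ha⟩
  have key : ∀ i, ∃ w, τ.tmul (Function.update (fun _ => Pi.single 0 1) i (u i)) =
      τ.tmul.toLinearMap (fun _ => Pi.single 0 1) i₀ w := fun i => by
    by_cases hi : i = i₀
    · subst hi
      exact ⟨u i, rfl⟩
    · have h1 : u i = u i 0 • Pi.single 0 1 := funext fun a => by
        by_cases ha : a = 0
        · subst ha
          simp
        · simp [hi₀ i hi a ha, ha]
      refine ⟨u i 0 • Pi.single 0 1, ?_⟩
      rw [MultilinearMap.toLinearMap_apply, h1, τ.tmul.map_update_smul, τ.tmul.map_update_smul,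
        Function.update_eq_self_iff.2 rfl, Function.update_eq_self_iff.2 rfl]
      simp
  choose w hw using key
  rw [MultilinearMap.linearDeriv_apply]
  simp only [hw]
  rw [← map_sum]
  exact ⟨_, rfl⟩

variable {τ} {B : LinearMap.BilinForm ℂ V}

/-- The infinitesimal orbit of the base point is the image of the derivative of the tensor product
map. In this form its orthogonal complement is visibly linear in `l`. -/
theorem moment_base_iff (l : V) : Moment τ B τ.base l ↔
    l ∈ B.orthogonal (τ.tmul.linearDeriv (fun _ => Pi.single 0 1)).range := by
  rw [LinearMap.BilinForm.mem_orthogonal_iff]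
  constructor
  · rintro h _ ⟨u, rfl⟩
    show B _ l = 0
    rw [← τ.der_raise_base, τ.der_apply, map_sum, LinearMap.sum_apply]
    exact Finset.sum_eq_zero fun i _ => h i _
  · intro h i A
    have h1 := h _ ⟨Pi.single i (A (Pi.single 0 1)), rfl⟩
    rw [MultilinearMap.linearDeriv_apply, Finset.sum_eq_single i, Pi.single_eq_same,
      ← τ.actAt_tmul] at h1
    · exact h1
    · intro j _ hj
      rw [Pi.single_eq_of_ne hj]
      exact τ.tmul.map_coord_zero j (Function.update_self ..)
    · simp

/-- Operators on different factors commute, and the terms with both operators on factor `i` are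
orthogonal to `l` by the moment condition. -/
theorem apply_der_actAt_base (A : ∀ i, End ℂ (Fin (n i) → ℂ)) (i : Fin p)
    (C : End ℂ (Fin (n i) → ℂ)) {l : V} (hl : Moment τ B τ.base l) :
    B (τ.der A (τ.actAt i C τ.base)) l = B (τ.actAt i C (τ.der A τ.base)) l := by
  rw [τ.der_apply, τ.der_apply, map_sum, map_sum, map_sum, LinearMap.sum_apply,
    LinearMap.sum_apply]
  refine Finset.sum_congr rfl fun j _ => ?_
  by_cases hj : j = i
  · subst hj
    rw [τ.actAt_actAt, τ.actAt_actAt, hl, hl]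
  · rw [τ.actAt_comm hj]

end TensorModel

namespace IsProductForm

variable {τ : TensorModel n V} {β : ∀ i, LinearMap.BilinForm ℂ (Fin (n i) → ℂ)}
  {B : LinearMap.BilinForm ℂ V} (hB : IsProductForm τ β B)

include hB

theorem nondegenerate_form : B.Nondegenerate :=
  ⟨fun _ h => hB.eq_zero_of_forall_left fun y => by rw [hB.comm, h],
    fun _ h => hB.eq_zero_of_forall_left h⟩

theorem exists_der_adjoint (A : ∀ i, End ℂ (Fin (n i) → ℂ)) :
    ∃ A', ∀ x y, B (τ.der A x) y = B x (τ.der A' y) := by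
  choose A' hA' using fun i => hB.exists_actAt_adjoint i (A i)
  refine ⟨A', fun x y => ?_⟩
  rw [τ.der_apply, τ.der_apply, map_sum, map_sum, LinearMap.sum_apply]
  exact Finset.sum_congr rfl fun i _ => hA' i x y

variable [∀ i, NeZero (n i)] [FiniteDimensional ℂ V]

/-- Normal vectors of the dual cone are tangent to the cone of rank-one tensors. -/
theorem exists_linearDeriv {l x : V} (hl : Moment τ B τ.base l)
    (hx : x ∈ normalSpace B (dualCone τ B) l) :
    ∃ u, x = τ.tmul.linearDeriv (fun _ => Pi.single 0 1) u := by
  -- The dual cone contains the linear space of all `l` normal at the base point, so `x` is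
  -- orthogonal to it; double orthogonality finishes.
  have h : x ∈ B.orthogonal (B.orthogonal
      (τ.tmul.linearDeriv (fun _ => Pi.single 0 1)).range) := by
    rw [LinearMap.BilinForm.mem_orthogonal_iff]
    intro v hv
    rw [normalSpace, LinearMap.BilinForm.mem_orthogonal_iff] at hx
    refine hx v (mem_tangentSpace_of_line fun t => ⟨τ.base, τ.base_mem, τ.base_ne_zero, ?_⟩)
    rw [TensorModel.moment_base_iff] at hl ⊢
    exact Submodule.add_mem _ hl (Submodule.smul_mem _ t hv)
  rw [LinearMap.BilinForm.orthogonal_orthogonal hB.nondegenerate_form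
    fun x y h => by rw [hB.comm, h]] at h
  obtain ⟨u, rfl⟩ := h
  exact ⟨u, rfl⟩

/-- The second-order condition satisfied by the normal vectors of the dual cone. -/
theorem apply_der_der_eq_zero (hp : 1 ≤ p) {A : ∀ i, End ℂ (Fin (n i) → ℂ)} {l v : V}
    (hl : Moment τ B τ.base l) (hv : Moment τ B τ.base v)
    (hx : τ.der A τ.base ∈ normalSpace B (dualCone τ B) l) :
    B (τ.der A (τ.der A τ.base)) v = 0 := by
  obtain ⟨A', hA'⟩ := hB.exists_der_adjoint A
  rw [normalSpace, LinearMap.BilinForm.mem_orthogonal_iff] at hx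
  obtain ⟨f, hf, hf0, hgrad⟩ := exists_gradient (φ := B.flip (τ.der A τ.base)) hx
  have hS : ∀ w, Moment τ B τ.base w → w ∈ dualCone τ B := fun w hw =>
    ⟨τ.base, τ.base_mem, τ.base_ne_zero, hw⟩
  have hline : ∀ w, Moment τ B τ.base w → ∀ t : ℂ, Moment τ B τ.base (l + t • w) := fun w hw t => by
    rw [TensorModel.moment_base_iff] at hl hw ⊢
    exact Submodule.add_mem _ hl (Submodule.smul_mem _ t hw)
  have htan : ∀ y ∈ dualCone τ B, τ.der A' y ∈ tangentSpace (dualCone τ B) y := fun y hy => by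
    rw [τ.der_apply]
    exact Submodule.sum_mem _ fun i _ => τ.actAt_mem_tangentSpace (hB.act_mem_dualCone hp) hy i _
  -- This makes `A' l` a direction inside `L`, so it is tangent to the dual cone at every point `l +
  -- t v`.
  have hAl : Moment τ B τ.base (τ.der A' l) := fun i C => by
    obtain ⟨C', hC'⟩ := hB.exists_actAt_adjoint i C
    rw [← hA', TensorModel.apply_der_actAt_base A i C hl, hC', hB.comm]
    exact hx _ (τ.actAt_mem_tangentSpace (hB.act_mem_dualCone hp) (hS l hl) i C')
  -- At `l + t v` both `A' l + t A' v` and `A' l` are tangent. Subtracting and dividing by `t`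
  -- leaves `A' v`, and the limit at `t = 0` is the claim at `l`.
  have hzero : ∀ t : ℂ, t ≠ 0 → differential hf (l + t • v) (τ.der A' v) = 0 := fun t ht => by
    have h1 := mem_tangentSpace.1 (htan _ (hS _ (hline v hv t))) f hf hf0
    have h2 := mem_tangentSpace.1 (mem_tangentSpace_of_line (X := dualCone τ B)
      (x := l + t • v) (v := τ.der A' l) fun s => by
        refine hS _ ?_
        have h3 := hline v hv t
        rw [TensorModel.moment_base_iff] at h3 hAl ⊢
        exact Submodule.add_mem _ h3 (Submodule.smul_mem _ s hAl)) f hf hf0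
    rw [map_add, map_smul, map_add, map_smul, h2, zero_add, smul_eq_mul] at h1
    exact (mul_eq_zero.1 h1).resolve_left ht
  have h4 : l ∈ {y | ∀ _ : Unit, differential hf y (τ.der A' v) = 0} :=
    mem_of_frequently_line (v := v)
      (isZariskiClosed_zeros fun _ => differential_mem_polyFun hf (τ.der A' v))
      (Filter.Eventually.frequently
        (eventually_nhdsWithin_of_forall fun t (ht : t ≠ 0) _ => hzero t ht))
  rw [hA', hB.comm]
  exact (hgrad _).trans (h4 ())

theorem mem_range_of_mem_normalSpace_of_base (hp : 1 ≤ p) {l x : V} (hl : Moment τ B τ.base l)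
    (hx : x ∈ normalSpace B (dualCone τ B) l) : x ∈ Set.range τ.tmul := by
  obtain ⟨u, rfl⟩ := hB.exists_linearDeriv hl hx
  rw [← τ.der_raise_base] at hx
  refine τ.linearDeriv_mem_range hp fun i j hij a b ha hb => ?_
  obtain ⟨d, hd⟩ := hB.exists_dualBasis
  -- The test vector is dual to the basis tensor with entry `a` in slot `i`, `b` in slot `j` and 0
  -- elsewhere; pairing with it reads off that coordinate.
  have hv : Moment τ B τ.base (d (Function.update (Function.update 0 j b) i a)) := by
    rw [TensorModel.moment_base_iff, LinearMap.BilinForm.mem_orthogonal_iff]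
    rintro _ ⟨w, rfl⟩
    show B _ _ = 0
    rw [← τ.der_raise_base, ← repr_eq_of_dualBasis hd]
    refine τ.repr_der_raise_base_pair w hij ?_ ?_
    · rwa [Function.update_self]
    · rwa [Function.update_of_ne hij.symm, Function.update_self]
  have h1 := hB.apply_der_der_eq_zero hp hl hv hx
  rw [← repr_eq_of_dualBasis hd, τ.repr_der_raise_der_raise u hij ha hb] at h1
  exact (mul_eq_zero.1 h1).resolve_left two_ne_zero

/-- Every normal vector of the dual cone has rank at most one. -/
theorem mem_range_of_mem_normalSpace (hp : 1 ≤ p) {x y : V} (hy : y ∈ dualCone τ B)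
    (hx : x ∈ normalSpace B (dualCone τ B) y) : x ∈ Set.range τ.tmul := by
  obtain ⟨a, ha, ha0, hay⟩ := hy
  obtain ⟨h, k, l, hh, -, hkh, -, rfl, hl⟩ := hB.exists_act_of_moment ha ha0 hay
  obtain ⟨h', hh1, hh2⟩ := isUnit_iff_exists.1 hh
  have hx' : x = τ.act h (τ.act h' x) := by
    rw [← τ.act_mul_apply, hh1, map_one, Module.End.one_apply]
  rw [hx']
  -- Rank is invariant under the action, and the contragredient pair carries normality at `k l` back
  -- to normality at `l`.
  refine τ.act_mem_range h _ (hB.mem_range_of_mem_normalSpace_of_base hp hl ?_)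
  rw [normalSpace, LinearMap.BilinForm.mem_orthogonal_iff] at hx ⊢
  intro v hv
  have h1 := hx _ (map_mem_tangentSpace (τ.act k) (hB.act_mem_dualCone hp k) hv)
  show B v _ = 0
  rw [hB.comm, ← hkh, ← hx', hB.comm]
  exact h1

end IsProductForm

end NormalVectors

/-! ### Data loci and the degenerate zero space -/

section DataLoci

variable {p : ℕ} {n : Fin p → ℕ} {V : Type*} [AddCommGroup V] [Module ℂ V]

section Subsingleton

variable [Subsingleton V] (B : LinearMap.BilinForm ℂ V)

theorem mem_regularPoints_of_subsingleton {X : Set V} {x : V} (hx : x ∈ X) :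
    x ∈ regularPoints X := by
  refine ⟨hx, ?_⟩
  have h : Algebra.IsAlgebraic ℂ (coordRing X) := ⟨fun f => by
    have h1 : f = algebraMap ℂ (coordRing X) (f.1 ⟨x, hx⟩) :=
      Subtype.ext (funext fun z => congrArg f.1 (Subsingleton.elim z ⟨x, hx⟩))
    rw [h1]
    exact isAlgebraic_algebraMap _⟩
  rw [trdeg_eq_zero, finrank_zero_of_subsingleton, Nat.cast_zero]

theorem mem_conormal_of_subsingleton {X : Set V} (hX : X.Nonempty) (q : V × V) :
    q ∈ conormal B X := by
  obtain ⟨x, hx⟩ := hX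
  have h := mem_conormal (mem_regularPoints_of_subsingleton hx)
    (normalSpace B X x).zero_mem
  rwa [Subsingleton.elim q (x, 0)]

theorem dataLocus_nonempty_of_subsingleton {X A : Set V} (hX : X.Nonempty) (hA : A.Nonempty) :
    (dataLocus B X (dualVariety B X ∩ A)).Nonempty := by
  obtain ⟨a, ha⟩ := hA
  have h : a ∈ dualVariety B X :=
    subset_zariskiClosure _ ⟨(a, a), mem_conormal_of_subsingleton B hX _, rfl⟩
  exact ⟨a, subset_zariskiClosure _ ⟨(a, a, a), ⟨subset_zariskiClosure _
    ⟨mem_conormal_of_subsingleton B ⟨a, h⟩ _, Subsingleton.elim _ _⟩, h, ha⟩, rfl⟩⟩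

theorem DL_nonempty_of_subsingleton {X : Set V} (hX : X.Nonempty) (r : ℕ) :
    (DL B X (r + 1)).Nonempty := by
  induction r with
  | zero => exact hX
  | succ r ih => exact dataLocus_nonempty_of_subsingleton B hX ih

end Subsingleton

namespace IsProductForm

variable {τ : TensorModel n V} {β : ∀ i, LinearMap.BilinForm ℂ (Fin (n i) → ℂ)}
  {B : LinearMap.BilinForm ℂ V} (hB : IsProductForm τ β B)

include hB

variable [∀ i, NeZero (n i)] [FiniteDimensional ℂ V]

/-- The three conditions hold over regular points and are each closed, so they survive the closure.
The moment condition transfers to `x` because the infinitesimal orbit of `y` is tangent to the dual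
cone. -/
theorem of_mem_conormal_dualCone (hp : 1 ≤ p) {q : V × V} (hq : q ∈ conormal B (dualCone τ B)) :
    q.1 ∈ dualCone τ B ∧ q.2 ∈ Set.range τ.tmul ∧ Moment τ B q.2 q.1 := by
  have hS : ∀ z ∈ {q : V × V | q.1 ∈ regularPoints (dualCone τ B) ∧
      q.2 ∈ normalSpace B (dualCone τ B) q.1}, z.1 ∈ dualCone τ B ∧ z.2 ∈ Set.range τ.tmul ∧
      Moment τ B z.2 z.1 := by
    rintro ⟨y, x⟩ ⟨hy, hx⟩
    refine ⟨hy.1, hB.mem_range_of_mem_normalSpace hp hy.1 hx, fun i A => ?_⟩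
    obtain ⟨A', hA'⟩ := hB.exists_actAt_adjoint i A
    rw [normalSpace, LinearMap.BilinForm.mem_orthogonal_iff] at hx
    rw [hA', hB.comm]
    exact hx _ (τ.actAt_mem_tangentSpace (hB.act_mem_dualCone hp) hy.1 i A')
  refine ⟨?_, ?_, ?_⟩
  · exact mem_of_mem_zariskiClosure (isZariskiClosed_dualCone hp)
      (isPolyMap_linearMap (LinearMap.fst ℂ V V)) (fun z hz => (hS z hz).1) hq
  · exact mem_of_mem_zariskiClosure (τ.isZariskiClosed_range hp)
      (isPolyMap_linearMap (LinearMap.snd ℂ V V)) (fun z hz => (hS z hz).2.1) hq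
  · exact mem_of_mem_zariskiClosure (isZariskiClosed_moment (τ := τ) (B := B))
      (isPolyMap_linearMap ((LinearMap.snd ℂ V V).prod (LinearMap.fst ℂ V V)))
      (fun z hz => (hS z hz).2.2) hq

/-- Con(X*) and the graph of addition are closed, so the closure in the joint correspondence adds no
points. -/
theorem of_mem_jointED (hp : 1 ≤ p) {q : V × V × V} (hq : q ∈ jointED B (dualCone τ B)) :
    q.1 ∈ dualCone τ B ∧ q.2.1 ∈ Set.range τ.tmul ∧ Moment τ B q.2.1 q.1 ∧
      q.2.2 = q.1 + q.2.1 := by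
  have h1 : (q.1, q.2.1) ∈ conormal B (dualCone τ B) :=
    mem_of_mem_zariskiClosure (isZariskiClosed_zariskiClosure _)
      (isPolyMap_linearMap ((LinearMap.fst ℂ V (V × V)).prod
        (LinearMap.fst ℂ V V ∘ₗ LinearMap.snd ℂ V (V × V)))) (fun z hz => hz.1) hq
  have h2 := hB.of_mem_conormal_dualCone hp h1
  refine ⟨h2.1, h2.2.1, h2.2.2, sub_eq_zero.1 ((forall_dual_apply_eq_zero_iff ℂ _).1 fun ψ => ?_)⟩
  exact hq _ (dual_mem_polyFun (ψ ∘ₗ (LinearMap.snd ℂ V V ∘ₗ LinearMap.snd ℂ V (V × V) -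
    (LinearMap.fst ℂ V (V × V) + LinearMap.fst ℂ V V ∘ₗ LinearMap.snd ℂ V (V × V)))))
    fun z hz => by simp [hz.2]

theorem zero_mem_conormal_dualCone (hp : 1 ≤ p) : ((0, 0) : V × V) ∈ conormal B (dualCone τ B) := by
  refine mem_of_frequently_line (C := conormal B (dualCone τ B)) (v := (0, τ.base))
    (isZariskiClosed_zariskiClosure _)
    (Filter.Eventually.frequently (eventually_nhdsWithin_of_forall fun t (ht : t ≠ 0) => ?_))
  have h := hB.mem_conormal_dualCone hp (x := t • τ.base) (y := 0)
    (τ.smul_mem_range hp t _ τ.base_mem) (smul_ne_zero ht τ.base_ne_zero) fun _ _ => map_zero _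
  simpa using h

/-- The data locus of a subvariety of the dual variety consists of the sums of rank-one tensors
and normal vectors in the subvariety. -/
theorem dataLocus_inter_eq (hp : 1 ≤ p) (D : Set V) :
    dataLocus B (Set.range τ.tmul) (dualVariety B (Set.range τ.tmul) ∩ D) =
      zariskiClosure {T | ∃ x ∈ regularPoints (Set.range τ.tmul),
        ∃ y ∈ normalSpace B (Set.range τ.tmul) x, y ∈ D ∧ T = x + y} := by
  have key : ∀ x ∈ Set.range τ.tmul, x ≠ 0 → ∀ y ∈ D, Moment τ B x y →
      x + y ∈ {T | ∃ x ∈ regularPoints (Set.range τ.tmul),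
        ∃ y ∈ normalSpace B (Set.range τ.tmul) x, y ∈ D ∧ T = x + y} := fun x hx hx0 y hy hxy =>
    ⟨x, (τ.regular_range hp hx hx0).1, y, (τ.mem_normalSpace_range hp B hx hx0).2 hxy, hy, rfl⟩
  rw [dataLocus, hB.dualVariety_range hp]
  refine Set.Subset.antisymm
    (zariskiClosure_minimal ?_ (isZariskiClosed_zariskiClosure _)) (zariskiClosure_mono ?_)
  · rintro _ ⟨⟨y, x, T⟩, ⟨hq, -, hyD⟩, rfl⟩
    obtain ⟨hy, hx, hxy, hT⟩ := hB.of_mem_jointED hp hq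
    change T ∈ _
    obtain rfl : T = y + x := hT
    rw [add_comm]
    -- The vertex need not be a regular point. Then `y` is recovered as the limit of `t x' + y`,
    -- where `x'` is a nonzero rank-one tensor to which `y` is normal.
    by_cases hx0 : x = 0
    · obtain ⟨x', hx', hx0', hxy'⟩ := hy
      rw [hx0, zero_add]
      refine mem_of_frequently_line (v := x') (isZariskiClosed_zariskiClosure _)
        (Filter.Eventually.frequently (eventually_nhdsWithin_of_forall fun t (ht : t ≠ 0) => ?_))
      rw [add_comm]
      exact subset_zariskiClosure _ (key _ (τ.smul_mem_range hp t _ hx')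
        (smul_ne_zero ht hx0') y hyD (hxy'.smul t))
    · exact subset_zariskiClosure _ (key x hx hx0 y hyD hxy)
  · rintro _ ⟨x, hx, y, hy, hyD, rfl⟩
    have h : (y, x) ∈ conormal B (dualCone τ B) := by
      -- The vertex can be regular, for instance when `p = 1`; its only normal vector is 0.
      by_cases hx0 : x = 0
      · subst hx0
        rw [hB.normalSpace_range_zero hp hy]
        exact hB.zero_mem_conormal_dualCone hp
      · exact hB.mem_conormal_dualCone hp hx.1 hx0 ((τ.mem_normalSpace_range hp B hx.1 hx0).1 hy)
    exact ⟨(y, x, x + y), ⟨subset_zariskiClosure _ ⟨h, add_comm x y⟩,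
      (hB.of_mem_conormal_dualCone hp h).1, hyD⟩, rfl⟩

end IsProductForm

section Tensors

/-- The standard model of the tensor space. -/
def tensorModel (n : Fin p → ℕ) : TensorModel n (TensorSpace n) where
  tmul := PiTensorProduct.tprod ℂ
  basis := Basis.piTensorProduct fun i => Pi.basisFun ℂ (Fin (n i))
  basis_apply J := by simp [Basis.piTensorProduct_apply]

theorem isProductForm_bwForm (G : ∀ i, Matrix (Fin (n i)) (Fin (n i)) ℝ)
    (hG : ∀ i, (G i).PosDef) : IsProductForm (tensorModel n)
      (fun i => Matrix.toBilin' ((G i).map ((↑) : ℝ → ℂ))) (bwForm G) where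
  nondegenerate i := LinearMap.BilinForm.nondegenerate_toBilin'_of_det_ne_zero' _ (by
    have h : ((G i).map ((↑) : ℝ → ℂ)).det = ((G i).det : ℂ) :=
      (RingHom.map_det Complex.ofRealHom (G i)).symm
    rw [h]
    exact Complex.ofReal_ne_zero.2 (hG i).det_pos.ne')
  symm i u v := by
    rw [Matrix.toBilin'_apply, Matrix.toBilin'_apply, Finset.sum_comm]
    refine Finset.sum_congr rfl fun j _ => Finset.sum_congr rfl fun k _ => ?_
    have h : G i k j = G i j k := by
      have := (hG i).isHermitian.apply j k
      simpa using this
    rw [Matrix.map_apply, Matrix.map_apply, h]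
    ring
  apply_tmul x y := by
    refine (bwForm_tprod G x y).trans (Finset.prod_congr rfl fun i _ => ?_)
    rw [Matrix.toBilin'_apply]
    rfl

theorem rankOne_nonempty : (rankOne n).Nonempty := Set.range_nonempty _

theorem subsingleton_tensorSpace {i : Fin p} (hi : n i = 0) : Subsingleton (TensorSpace n) := by
  have : IsEmpty (∀ i, Fin (n i)) := ⟨fun J => (hi ▸ J i : Fin 0).elim0⟩
  exact (tensorModel n).basis.repr.toEquiv.subsingleton

end Tensors

end DataLoci

end TensorDataLocus

end

theorem mainTheorem5 (p : ℕ) (hp : 1 ≤ p) (n : Fin p → ℕ)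
    (G : ∀ i, Matrix (Fin (n i)) (Fin (n i)) ℝ) (hG : ∀ i, (G i).PosDef)
    (r : ℕ) (hr : 2 ≤ r) :
    TensorDataLocus.DL (TensorDataLocus.bwForm G) (TensorDataLocus.rankOne n) r =
      TensorDataLocus.zariskiClosure
        {T | ∃ x ∈ TensorDataLocus.regularPoints (TensorDataLocus.rankOne n),
          ∃ y ∈ TensorDataLocus.normalSpace (TensorDataLocus.bwForm G)
              (TensorDataLocus.rankOne n) x,
            y ∈ TensorDataLocus.DL (TensorDataLocus.bwForm G)
              (TensorDataLocus.rankOne n) (r - 1) ∧ T = x + y} := by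
  open TensorDataLocus in
  obtain ⟨k, rfl⟩ := Nat.exists_eq_add_of_le' hr
  rw [show k + 2 - 1 = k + 1 from rfl]
  by_cases hn : ∀ i, NeZero (n i)
  · have := Module.Finite.of_basis (tensorModel n).basis
    -- The recursion for `DL` at `k + 2` unfolds to the data locus with `D` equal to its value at `k
    -- + 1`.
    exact (isProductForm_bwForm G hG).dataLocus_inter_eq hp _
  -- If some `n i` is 0, there is no base point, but `V` is the zero space and both sides are
  -- nonempty.
  · simp only [not_forall, not_neZero] at hn
    obtain ⟨i, hi⟩ := hn
    have := subsingleton_tensorSpace hi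
    obtain ⟨x, hx⟩ := rankOne_nonempty (n := n)
    obtain ⟨y, hy⟩ := DL_nonempty_of_subsingleton (bwForm G) ⟨x, hx⟩ k
    obtain ⟨z, hz⟩ := DL_nonempty_of_subsingleton (bwForm G) ⟨x, hx⟩ (k + 1)
    have hy0 : y ∈ normalSpace (bwForm G) (rankOne n) x := by
      rw [Subsingleton.elim y 0]
      exact Submodule.zero_mem _
    have hxy := subset_zariskiClosure {T | ∃ x ∈ regularPoints (rankOne n),
      ∃ y ∈ normalSpace (bwForm G) (rankOne n) x,
        y ∈ DL (bwForm G) (rankOne n) (k + 1) ∧ T = x + y}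
      ⟨x, mem_regularPoints_of_subsingleton hx, y, hy0, hy, rfl⟩
    ext T
    exact iff_of_true (Subsingleton.elim z T ▸ hz) (Subsingleton.elim (x + y) T ▸ hxy)
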